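/- Let $G$ be a finite-dimensional (real or complex) Lie group with Lie algebra $L$, and let $H_1,\dots,H_d$ be a basis of $L$ with dual basis $X^1,\dots,X^d$ of $L^*$. Let $\rho\colon L\to\mathrm{End}(L)$, $x\triangleright v=\rho(x)v$, be a left action (a Lie algebra representation) of $L$ on its own underlying vector space, not necessarily the adjoint one, which is the differential at the identity of a smooth linear action $a\triangleright v$ of $G$ on $L$. Let $\varphi\colon G\to L$ be a smooth group 1-cocycle, that is, $$\varphi(ba)=\varphi(a)+a^{-1}\triangleright\varphi(b)\qquad(a,b\in G).$$ Regard $\varphi$, through the exponential map of $G$, as the map $x\mapsto\varphi(\exp x)$ on a neighbourhood of the origin of $L$, suppose that it is invertible near the origin, and let $\psi$ be its local inverse, so that $\psi(\varphi(\exp x))=x$ and $\varphi(\exp\psi(y))=y$ for $x,y\in L$ near $0$. Write $\psi^\nu$ for the coordinates of $\psi$ in the basis $H_\nu$, and $\psi^\nu(X)$ for the Taylor series of $\psi^\nu$ at $0$ in the variables $X^1,\dots,X^d$. Let $L\triangleright L^*$ be the semidirect sum of $L$ and the abelian Lie algebra $L^*$, on which $L$ acts by the conjugate action $(x\triangleright\xi)(v)=-\xi(x\triangleright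 v)$. Let $U=U(L\triangleright L^*)$ be its universal enveloping Hopf algebra, with coproduct $\Delta$ and counit $\varepsilon$ for which the elements of $L\triangleright L^*$ are primitive, graded by giving $L$ degree $0$ and $L^*$ degree $1$; let $U\hat\otimes U$ and $U\hat\otimes U\hat\otimes U$ denote the completions of the tensor powers of $U$ with respect to the total degree, whose elements are the formal sums $\sum_{n\ge0}a_n$ with $a_n$ homogeneous of degree $n$. Then $$\Phi=\exp\Bigl(-\sum_\nu\psi^\nu(X)\otimes H_\nu\Bigr)\in U\hat\otimes U$$ is a twisting cocycle for $U$: it is invertible in $U\hat\otimes U$ and satisfies $$(\Delta\otimes\mathrm{id})(\Phi)\,\Phi_{12}=(\mathrm{id}\otimes\Delta)(\Phi)\,\Phi_{23},\qquad(\varepsilon\otimes\mathrm{id})(\Phi)=(\mathrm{id}\otimes\varepsilon)(\Phi)=1 .$$ -/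

import Mathlib

open scoped Manifold ContDiff Topology TensorProduct

attribute [local instance 100] LieRing.ofAssociativeRing

/-! ### Universal enveloping algebras as bialgebras -/

namespace UniversalEnvelopingAlgebra

section

variable (K : Type*) (L : Type*) [CommRing K] [LieRing L] [LieAlgebra K L]

/-- The map `x ↦ x ⊗ 1 + 1 ⊗ x` from a Lie algebra to `U(L) ⊗ U(L)`. -/
noncomputable def primitiveHom :
    L →ₗ⁅K⁆ UniversalEnvelopingAlgebra K L ⊗[K] UniversalEnvelopingAlgebra K L where
  toFun x := ι K x ⊗ₜ[K] 1 + 1 ⊗ₜ[K] ι K x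
  map_add' x y := by
    simp only [map_add, TensorProduct.add_tmul, TensorProduct.tmul_add]
    abel
  map_smul' c x := by
    simp only [map_smul, TensorProduct.smul_tmul', TensorProduct.tmul_smul, smul_add,
      RingHom.id_apply]
  map_lie' {x y} := by
    simp only [LieHom.map_lie, LieRing.of_associative_ring_bracket, mul_add, add_mul,
      Algebra.TensorProduct.tmul_mul_tmul, one_mul, mul_one, TensorProduct.sub_tmul,
      TensorProduct.tmul_sub]
    abel

/-- The coproduct of `U(L)`: elements of `L` are primitive. -/
noncomputable def comulHom : UniversalEnvelopingAlgebra K L →ₐ[K]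
    UniversalEnvelopingAlgebra K L ⊗[K] UniversalEnvelopingAlgebra K L :=
  lift K (primitiveHom K L)

/-- The counit of `U(L)`: it vanishes on `L`. -/
noncomputable def counitHom : UniversalEnvelopingAlgebra K L →ₐ[K] K :=
  lift K (0 : L →ₗ⁅K⁆ K)

theorem comulHom_ι (x : L) :
    comulHom K L (ι K x) = ι K x ⊗ₜ[K] 1 + 1 ⊗ₜ[K] ι K x :=
  lift_ι_apply K (primitiveHom K L) x

theorem counitHom_ι (x : L) : counitHom K L (ι K x) = 0 :=
  lift_ι_apply K (0 : L →ₗ⁅K⁆ K) x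

theorem algHom_ext_of_ι {A : Type*} [Ring A] [Algebra K A]
    {f g : UniversalEnvelopingAlgebra K L →ₐ[K] A} (h : ∀ x, f (ι K x) = g (ι K x)) : f = g := by
  apply hom_ext
  ext x
  exact h x

/-- The standard bialgebra structure of `U(L)`. -/
noncomputable instance instBialgebra : Bialgebra K (UniversalEnvelopingAlgebra K L) :=
  Bialgebra.ofAlgHom (comulHom K L) (counitHom K L)
    (by
      apply algHom_ext_of_ι
      intro x
      simp [comulHom_ι, TensorProduct.add_tmul, TensorProduct.tmul_add,
        Algebra.TensorProduct.one_def, -ι_apply]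
      abel)
    (by
      apply algHom_ext_of_ι
      intro x
      simp [comulHom_ι, counitHom_ι, -ι_apply])
    (by
      apply algHom_ext_of_ι
      intro x
      simp [comulHom_ι, counitHom_ι, -ι_apply])

end

end UniversalEnvelopingAlgebra

/-! ### The semidirect sum of `L` and the abelian Lie algebra `L*` -/

/-- The dual space of `L`, regarded as an abelian Lie algebra. -/
def AbelianDual (K L : Type*) [CommRing K] [AddCommGroup L] [Module K L] : Type _ :=
  Module.Dual K L

namespace AbelianDual

section

variable (K L : Type*) [CommRing K] [AddCommGroup L] [Module K L]

noncomputable instance : AddCommGroup (AbelianDual K L) :=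
  inferInstanceAs (AddCommGroup (Module.Dual K L))

noncomputable instance : Module K (AbelianDual K L) :=
  inferInstanceAs (Module K (Module.Dual K L))

/-- The bracket on `L*` is zero. -/
noncomputable instance : LieRing (AbelianDual K L) where
  bracket _ _ := 0
  add_lie _ _ _ := (add_zero _).symm
  lie_add _ _ _ := (add_zero _).symm
  lie_self _ := rfl
  leibniz_lie _ _ _ := (add_zero _).symm

noncomputable instance : LieAlgebra K (AbelianDual K L) where
  lie_smul t _ _ := (smul_zero t).symm

/-- The identification of the dual space with the underlying space of `AbelianDual`. -/
noncomputable def ofDual : Module.Dual K L ≃ₗ[K] AbelianDual K L := LinearEquiv.refl K _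

theorem lie_eq_zero (ξ η : AbelianDual K L) : ⁅ξ, η⁆ = 0 := rfl

end

end AbelianDual

section SemidirectSum

variable {K L : Type*} [CommRing K] [LieRing L] [LieAlgebra K L]

/-- The action `x ▷ ξ = - ξ ∘ ρ x` on `L*` which is conjugate to an action `ρ` of `L` on its own
underlying vector space. -/
noncomputable def dualAction (ρ : L →ₗ⁅K⁆ Module.End K L) :
    L →ₗ⁅K⁆ LieDerivation K (AbelianDual K L) (AbelianDual K L) where
  toFun x :=
    { toLinearMap := (AbelianDual.ofDual K L).toLinearMap ∘ₗ
        (-(Module.Dual.transpose (R := K) (ρ x))) ∘ₗ (AbelianDual.ofDual K L).symm.toLinearMap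
      leibniz' := fun a b => by
        simp [AbelianDual.lie_eq_zero] }
  map_add' x y := by
    ext ξ
    refine LinearMap.ext fun v => ?_
    change -(AbelianDual.ofDual K L).symm ξ (ρ (x + y) v) =
      -(AbelianDual.ofDual K L).symm ξ (ρ x v) + -(AbelianDual.ofDual K L).symm ξ (ρ y v)
    simp [add_comm]
  map_smul' c x := by
    ext ξ
    refine LinearMap.ext fun v => ?_
    change -(AbelianDual.ofDual K L).symm ξ (ρ (c • x) v) = c • -(AbelianDual.ofDual K L).symm ξ (ρ x v)
    simp
  map_lie' {x y} := by
    ext ξ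
    rw [LieDerivation.lie_apply]
    refine LinearMap.ext fun v => ?_
    change -(AbelianDual.ofDual K L).symm ξ (ρ ⁅x, y⁆ v) =
      - -(AbelianDual.ofDual K L).symm ξ (ρ y (ρ x v)) - - -(AbelianDual.ofDual K L).symm ξ (ρ x (ρ y v))
    simp [LieRing.of_associative_ring_bracket]

/-- The semidirect sum `L ▷ L*`. -/
abbrev SemidirectDual (ρ : L →ₗ⁅K⁆ Module.End K L) : Type _ :=
  LieAlgebra.SemiDirectSum (AbelianDual K L) L (dualAction ρ)

/-- The universal enveloping algebra `U(L ▷ L*)`. -/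
abbrev USemidirect (ρ : L →ₗ⁅K⁆ Module.End K L) : Type _ :=
  UniversalEnvelopingAlgebra K (SemidirectDual ρ)

/-- The inclusion `L → U(L ▷ L*)`. -/
noncomputable def genH (ρ : L →ₗ⁅K⁆ Module.End K L) : L →ₗ[K] USemidirect ρ :=
  (UniversalEnvelopingAlgebra.ι K : SemidirectDual ρ →ₗ⁅K⁆ USemidirect ρ).toLinearMap ∘ₗ
    (LieAlgebra.SemiDirectSum.inr (dualAction ρ)).toLinearMap

/-- The inclusion `L* → U(L ▷ L*)`. -/
noncomputable def genX (ρ : L →ₗ⁅K⁆ Module.End K L) : Module.Dual K L →ₗ[K] USemidirect ρ :=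
  (UniversalEnvelopingAlgebra.ι K : SemidirectDual ρ →ₗ⁅K⁆ USemidirect ρ).toLinearMap ∘ₗ
    (LieAlgebra.SemiDirectSum.inl (dualAction ρ)).toLinearMap ∘ₗ
      (AbelianDual.ofDual K L).toLinearMap

/-- The component of degree `n` of `U(L ▷ L*)`, for the grading in which `L` has degree `0` and
`L*` has degree `1`: the span of the products of `n` elements of `L*` with an element of `U(L)`. -/
noncomputable def degreePart (ρ : L →ₗ⁅K⁆ Module.End K L) (n : ℕ) :
    Submodule K (USemidirect ρ) :=
  LinearMap.range (genX ρ) ^ n *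
    Subalgebra.toSubmodule (Algebra.adjoin K (Set.range (genH ρ)))

end SemidirectSum

/-! ### Twisting cocycles in a completed tensor square

For a graded bialgebra `H`, an element of the completion of `H ⊗ H` with respect to the degree is a
formal sum `∑ aₙ` with `aₙ` homogeneous of degree `n`. It is encoded as the power series
`∑ aₙ Tⁿ`; the completions of `H` and of `H ⊗ H ⊗ H` are treated in the same way, and a homogeneous
algebra homomorphism extends to the completions coefficientwise. -/

section Twist

variable {K H : Type*} [CommRing K] [Ring H] [Bialgebra K H]

/-- The component of total degree `n` of `H ⊗ H`. -/
def tensorDegreePart (gr : ℕ → Submodule K H) (n : ℕ) : Submodule K (H ⊗[K] H) :=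
  ⨆ p ∈ Finset.HasAntidiagonal.antidiagonal n, Submodule.map₂ (TensorProduct.mk K H H) (gr p.1) (gr p.2)

/-- `Δ ⊗ id`. -/
noncomputable def comulLeft : H ⊗[K] H →ₐ[K] H ⊗[K] (H ⊗[K] H) :=
  (Algebra.TensorProduct.assoc K K K H H H).toAlgHom.comp
    (Algebra.TensorProduct.map (Bialgebra.comulAlgHom K H) (AlgHom.id K H))

/-- `id ⊗ Δ`. -/
noncomputable def comulRight : H ⊗[K] H →ₐ[K] H ⊗[K] (H ⊗[K] H) :=
  Algebra.TensorProduct.map (AlgHom.id K H) (Bialgebra.comulAlgHom K H)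

/-- The embedding `a ⊗ b ↦ a ⊗ b ⊗ 1`. -/
noncomputable def embed₁₂ : H ⊗[K] H →ₐ[K] H ⊗[K] (H ⊗[K] H) :=
  Algebra.TensorProduct.map (AlgHom.id K H) Algebra.TensorProduct.includeLeft

/-- The embedding `a ⊗ b ↦ 1 ⊗ a ⊗ b`. -/
noncomputable def embed₂₃ : H ⊗[K] H →ₐ[K] H ⊗[K] (H ⊗[K] H) :=
  Algebra.TensorProduct.includeRight

/-- `ε ⊗ id`. -/
noncomputable def counitLeft : H ⊗[K] H →ₐ[K] H :=
  (Algebra.TensorProduct.lid K H).toAlgHom.comp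
    (Algebra.TensorProduct.map (Bialgebra.counitAlgHom K H) (AlgHom.id K H))

/-- `id ⊗ ε`. -/
noncomputable def counitRight : H ⊗[K] H →ₐ[K] H :=
  (Algebra.TensorProduct.rid K K H).toAlgHom.comp
    (Algebra.TensorProduct.map (AlgHom.id K H) (Bialgebra.counitAlgHom K H))

/-- The coefficientwise extension of an algebra homomorphism to completions. -/
noncomputable def extend {A B : Type*} [Ring A] [Algebra K A] [Ring B] [Algebra K B]
    (f : A →ₐ[K] B) : PowerSeries A →+* PowerSeries B :=
  PowerSeries.map f.toRingHom

/-- `Φ` is a normalized twisting cocycle in the completion of `H ⊗ H` defined by the grading `gr`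
of `H`: an invertible element that satisfies
`(Δ ⊗ id)(Φ) Φ₁₂ = (id ⊗ Δ)(Φ) Φ₂₃` and `(ε ⊗ id)(Φ) = (id ⊗ ε)(Φ) = 1`. -/
structure IsTwistingCocycle (gr : ℕ → Submodule K H) (Φ : PowerSeries (H ⊗[K] H)) : Prop where
  homogeneous : ∀ n, PowerSeries.coeff n Φ ∈ tensorDegreePart gr n
  invertible : ∃ Ψ : PowerSeries (H ⊗[K] H),
    (∀ n, PowerSeries.coeff n Ψ ∈ tensorDegreePart gr n) ∧ Φ * Ψ = 1 ∧ Ψ * Φ = 1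
  twist : extend comulLeft Φ * extend embed₁₂ Φ = extend comulRight Φ * extend embed₂₃ Φ
  counit_left : extend counitLeft Φ = 1
  counit_right : extend counitRight Φ = 1

end Twist

/-- The exponential `∑ₖ Θᵏ / k!` of a power series `Θ` without constant term over a possibly
noncommutative algebra; the coefficient of degree `n` only involves the powers with `k ≤ n`. -/
noncomputable def formalExp (K : Type*) [Field K] {A : Type*} [Ring A] [Algebra K A]
    (Θ : PowerSeries A) : PowerSeries A :=
  PowerSeries.mk fun n =>
    ∑ k ∈ Finset.range (n + 1), ((k.factorial : K)⁻¹) • PowerSeries.coeff n (Θ ^ k)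

/-! ### Lie groups, the exponential map and group cocycles -/

instance instLEInftyMinSmoothness (𝕜 : Type*) [RCLike 𝕜] : ENat.LEInfty (minSmoothness 𝕜 3) where
  out := by
    rw [minSmoothness_of_isRCLikeNormedField]
    exact ENat.LEInfty.out

section LieGroup

variable {𝕜 : Type*} [RCLike 𝕜] {E : Type*} [NormedAddCommGroup E] [NormedSpace 𝕜 E]
  {G : Type*} [TopologicalSpace G] [ChartedSpace E G] [Group G]

/-- `γ` is the integral curve, starting at `1`, of the left invariant vector field with value `x`
at `1`; that is, the one-parameter subgroup with velocity `x`. -/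
def IsOneParameterSubgroup (x : GroupLieAlgebra 𝓘(𝕜, E) G) (γ : 𝕜 → G) : Prop :=
  γ 0 = 1 ∧ ∀ t : 𝕜, HasMFDerivAt 𝓘(𝕜, 𝕜) 𝓘(𝕜, E) γ t
    ((1 : 𝕜 →L[𝕜] 𝕜).smulRight (mulInvariantVectorField x (γ t)))

open Classical in
/-- The exponential map of a Lie group: the value at `1` of the one-parameter subgroup with
velocity `x` (which exists and is unique in a Lie group). -/
noncomputable def lieExp (x : GroupLieAlgebra 𝓘(𝕜, E) G) : G :=
  if h : ∃ γ : 𝕜 → G, IsOneParameterSubgroup x γ then h.choose 1 else 1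

/-- Smoothness of a map from `G` to a finite-dimensional vector space: all its coordinates are
smooth. -/
def IsSmoothVec (𝕜 E : Type*) [RCLike 𝕜] [NormedAddCommGroup E] [NormedSpace 𝕜 E]
    {G : Type*} [TopologicalSpace G] [ChartedSpace E G]
    {V : Type*} [AddCommGroup V] [Module 𝕜 V] (f : G → V) : Prop :=
  ∀ ξ : Module.Dual 𝕜 V, ContMDiff 𝓘(𝕜, E) 𝓘(𝕜, 𝕜) ∞ fun g => ξ (f g)

variable [CompleteSpace E] [LieGroup 𝓘(𝕜, E) ∞ G]

/-- The smooth action `π` of the group `G` on the vector space `L` has the action `ρ` of the Lie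
algebra `L` as its differential at the identity. -/
structure IntegratesAction
    (ρ : GroupLieAlgebra 𝓘(𝕜, E) G →ₗ⁅𝕜⁆ Module.End 𝕜 (GroupLieAlgebra 𝓘(𝕜, E) G))
    (π : Representation 𝕜 G (GroupLieAlgebra 𝓘(𝕜, E) G)) : Prop where
  smooth : ∀ v, IsSmoothVec 𝕜 E fun g => π g v
  deriv : ∀ (x v : GroupLieAlgebra 𝓘(𝕜, E) G)
    (ξ : Module.Dual 𝕜 (GroupLieAlgebra 𝓘(𝕜, E) G)),
    mfderiv 𝓘(𝕜, E) 𝓘(𝕜, 𝕜) (fun g => ξ (π g v)) 1 x = ξ (ρ x v)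

/-- `φ` is a (smooth) group 1-cocycle: `φ(ba) = φ(a) + a⁻¹ ▷ φ(b)`. -/
structure IsGroupCocycle (π : Representation 𝕜 G (GroupLieAlgebra 𝓘(𝕜, E) G))
    (φ : G → GroupLieAlgebra 𝓘(𝕜, E) G) : Prop where
  smooth : IsSmoothVec 𝕜 E φ
  cocycle : ∀ a b : G, φ (b * a) = φ a + π a⁻¹ (φ b)

/-- The map `φ`, read in exponential coordinates as a map from a neighbourhood of the origin of `L`
to `L`, is invertible near the origin, with inverse `ψ`. -/
structure IsInverseNearOrigin (φ : G → GroupLieAlgebra 𝓘(𝕜, E) G)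
    (ψ : GroupLieAlgebra 𝓘(𝕜, E) G → GroupLieAlgebra 𝓘(𝕜, E) G) : Prop where
  left_inv : ∀ᶠ x in 𝓝 (0 : GroupLieAlgebra 𝓘(𝕜, E) G), ψ (φ (lieExp x)) = x
  right_inv : ∀ᶠ y in 𝓝 (0 : GroupLieAlgebra 𝓘(𝕜, E) G), φ (lieExp (ψ y)) = y

end LieGroup

/-! ### The twisting element -/

section TwistingElement

variable {𝕜 : Type*} [RCLike 𝕜] {L : Type*} [LieRing L] [LieAlgebra 𝕜 L] {d : ℕ}

/-- The coordinate `ψ^ν` of `ψ : L → L`, as a function of the coordinates with respect to the basis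
`b`. -/
noncomputable def coordFun (b : Module.Basis (Fin d) 𝕜 L) (ψ : L → L) (ν : Fin d) :
    (Fin d → 𝕜) → 𝕜 :=
  fun y => b.coord ν (ψ (∑ i, y i • b i))

/-- `ψ^ν(X)`: the Taylor series of `ψ^ν` at the origin, evaluated at the commuting elements `X^μ`
of `U(L ▷ L*)` given by the basis of `L*` that is dual to `b`. Its part of degree `n` is
`(1/n!) ∑ ∂_{i₁} ⋯ ∂_{iₙ} ψ^ν(0) X^{i₁} ⋯ X^{iₙ}`. -/
noncomputable def taylorX (ρ : L →ₗ⁅𝕜⁆ Module.End 𝕜 L) (b : Module.Basis (Fin d) 𝕜 L)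
    (ψ : L → L) (ν : Fin d) : PowerSeries (USemidirect ρ) :=
  PowerSeries.mk fun n => ((n.factorial : 𝕜)⁻¹) • ∑ i : Fin n → Fin d,
    (iteratedFDeriv 𝕜 n (coordFun b ψ ν) 0 fun k => Pi.single (i k) 1) •
      (List.ofFn fun k => genX ρ (b.coord (i k))).prod

/-- `exp(- ∑_ν ψ^ν(X) ⊗ H_ν)`, where `H_ν` are the elements of the basis `b`. -/
noncomputable def twistingElement (ρ : L →ₗ⁅𝕜⁆ Module.End 𝕜 L) (b : Module.Basis (Fin d) 𝕜 L)
    (ψ : L → L) : PowerSeries (USemidirect ρ ⊗[𝕜] USemidirect ρ) :=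
  formalExp 𝕜 (PowerSeries.mk fun n =>
    -∑ ν, PowerSeries.coeff n (taylorX ρ b ψ ν) ⊗ₜ[𝕜] genH ρ (b ν))

end TwistingElement

/-!
Write `D = dφ₁`. By the cocycle identity `φ` maps the left invariant vector field of `x` to the
affine field `y ↦ D x - x ▷ y`. Invertibility of `φ ∘ exp` near `0` makes `D` injective, hence
bijective, and comparing brackets of fields shows that `D` is a Lie algebra 1-cocycle. So
`a(x)(v, t) = (x ▷ v + t D x, 0)` is a representation of `L` on `L × 𝕜`, and integrating along
one-parameter subgroups gives `exp(-a(x))(0, 1) = (-φ(exp x), 1)`. Hence `ψ` is analytic at `0` and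
`exp(-a(ψ(y)))(0, 1) = (-y, 1)` near `0`, an identity of Taylor series in `y`.

For the twist identity, both sides are products of exponentials of series in the Lie algebra
`S = 𝕜[X ⊗ 1 ⊗ 1, 1 ⊗ X ⊗ 1] · (1 ⊗ L ⊗ 1 + 1 ⊗ 1 ⊗ L)`. Let `p` be the projection of `L × 𝕜` onto
the line of `(0, 1)` and let `J` be the left ideal of those `m` with `(id ⊗ id ⊗ a)(m) p = 0`. The
displayed identity shows that the two sides agree modulo `J`. Since `D` is bijective, `S ∩ J = 0`,
and comparing logarithmic derivatives degree by degree shows that products of exponentials of `S`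
which agree modulo `J` are equal.
-/

/-! ### Formal exponentials over noncommutative algebras -/

open PowerSeries in
/-- The power series whose coefficients lie in a given submodule. -/
def coeffsIn {R A : Type*} [Semiring R] [Semiring A] [Module R A] (S : Submodule R A) :
    Submodule R (PowerSeries A) where
  carrier := {a | ∀ n, coeff n a ∈ S}
  add_mem' ha hb n := by rw [map_add]; exact S.add_mem (ha n) (hb n)
  zero_mem' n := by rw [map_zero]; exact S.zero_mem
  smul_mem' c _ ha n := by rw [coeff_smul]; exact S.smul_mem c (ha n)

/-- The Euler operator `T d/dT` on formal power series. -/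
noncomputable def euler (K : Type*) {A : Type*} [CommSemiring K] [Semiring A] [Algebra K A] :
    Module.End K (PowerSeries A) where
  toFun a := PowerSeries.mk fun n => n • PowerSeries.coeff n a
  map_add' a b := by ext n; simp only [PowerSeries.coeff_mk, map_add, smul_add]
  map_smul' c a := by
    ext n
    simp only [PowerSeries.coeff_mk, PowerSeries.coeff_smul, RingHom.id_apply, smul_comm n c]

section FormalExp

open PowerSeries
open Finset.HasAntidiagonal (antidiagonal)

variable {K : Type*} [Field K] {A B : Type*} [Ring A] [Algebra K A] [Ring B] [Algebra K B]

theorem extend_formalExp (f : A →ₐ[K] B) (Θ : A⟦X⟧) :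
    extend f (formalExp K Θ) = formalExp K (extend f Θ) := by
  ext n
  simp only [extend, formalExp, coeff_map, coeff_mk, map_sum, ← map_pow]
  exact Finset.sum_congr rfl fun k _ => map_smul f _ _

theorem coeff_formalExp_of_lt {Θ : A⟦X⟧} (hΘ : constantCoeff Θ = 0) {n N : ℕ} (h : n < N) :
    coeff n (formalExp K Θ) =
      coeff n (∑ k ∈ Finset.range N, ((k.factorial : K)⁻¹) • Θ ^ k) := by
  rw [formalExp, coeff_mk, map_sum]
  refine Finset.sum_subset (by simpa using h) fun k _ hk => ?_
  have hk : n < k := by simpa using hk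
  rw [coeff_of_lt_order n, smul_zero]
  exact (Nat.cast_lt.mpr hk).trans_le (le_order_pow_of_constantCoeff_eq_zero k hΘ)

theorem le_order_formalExp_sub {Θ : A⟦X⟧} (hΘ : constantCoeff Θ = 0) (N : ℕ) :
    N ≤ (formalExp K Θ - ∑ k ∈ Finset.range N, ((k.factorial : K)⁻¹) • Θ ^ k).order :=
  nat_le_order _ _ fun n hn => by rw [map_sub, coeff_formalExp_of_lt hΘ hn, sub_self]

theorem constantCoeff_formalExp (Θ : A⟦X⟧) : constantCoeff (formalExp K Θ) = 1 := by
  rw [← coeff_zero_eq_constantCoeff_apply, formalExp, coeff_mk]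
  simp

@[simp]
theorem formalExp_zero : formalExp K (0 : A⟦X⟧) = 1 := by
  ext n
  rw [formalExp, coeff_mk, Finset.sum_eq_single_of_mem 0 (by simp) fun k _ hk => by simp [hk]]
  simp

theorem le_order_smul_pow_mul_map {Θ Ξ : A⟦X⟧} (hΘ : constantCoeff Θ = 0)
    (hΞ : constantCoeff Ξ = 0) {D : Module.End K A⟦X⟧} (hD : ∀ a, a.order ≤ (D a).order)
    (c c' : K) (i j : ℕ) : (i + j : ℕ) ≤ ((c • Θ ^ i) * D (c' • Ξ ^ j)).order := by
  rw [map_smul, smul_mul_smul_comm, Nat.cast_add]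
  calc (i + j : ℕ∞) ≤ (Θ ^ i).order + (D (Ξ ^ j)).order :=
        add_le_add (le_order_pow_of_constantCoeff_eq_zero i hΘ)
          ((le_order_pow_of_constantCoeff_eq_zero j hΞ).trans (hD _))
    _ ≤ (Θ ^ i * D (Ξ ^ j)).order := le_order_mul _ _
    _ ≤ _ := by
      refine le_order _ _ fun m hm => ?_
      rw [coeff_smul, coeff_of_lt_order m hm, smul_zero]

theorem coeff_formalExp_mul_map_formalExp {Θ Ξ : A⟦X⟧} (hΘ : constantCoeff Θ = 0)
    (hΞ : constantCoeff Ξ = 0) {D : Module.End K A⟦X⟧} (hD : ∀ a, a.order ≤ (D a).order)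
    (n : ℕ) :
    coeff n (formalExp K Θ * D (formalExp K Ξ)) =
      ∑ m ∈ Finset.range (n + 1), coeff n (∑ p ∈ antidiagonal m,
        (((p.1.factorial : K)⁻¹) • Θ ^ p.1) * D (((p.2.factorial : K)⁻¹) • Ξ ^ p.2)) := by
  set t : ℕ → A⟦X⟧ := fun i => ((i.factorial : K)⁻¹) • Θ ^ i
  set u : ℕ → A⟦X⟧ := fun j => ((j.factorial : K)⁻¹) • Ξ ^ j
  set E := ∑ i ∈ Finset.range (n + 1), t i
  set F := ∑ j ∈ Finset.range (n + 1), u j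
  have truncate : coeff n (formalExp K Θ * D (formalExp K Ξ)) = coeff n (E * D F) := by
    have split : formalExp K Θ * D (formalExp K Ξ) - E * D F =
        (formalExp K Θ - E) * D (formalExp K Ξ) + E * D (formalExp K Ξ - F) := by
      rw [map_sub]
      noncomm_ring
    rw [← sub_eq_zero, ← map_sub, split]
    refine coeff_of_lt_order n (lt_of_lt_of_le (Nat.cast_lt.mpr n.lt_succ_self)
      ((le_min ?_ ?_).trans (min_order_le_order_add _ _)))
    · exact (le_order_formalExp_sub hΘ _).trans (le_self_add.trans (le_order_mul _ _))
    · exact ((le_order_formalExp_sub hΞ _).trans (hD _)).trans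
        (le_add_self.trans (le_order_mul _ _))
  rw [truncate, map_sum, Finset.sum_mul_sum, map_sum]
  simp only [map_sum]
  refine Eq.trans ?_ ((Finset.sum_range_diag_flip (n + 1)
    fun i j => coeff n (t i * D (u j))).symm.trans (Finset.sum_congr rfl fun m _ =>
      (Finset.Nat.sum_antidiagonal_eq_sum_range_succ (fun i j => coeff n (t i * D (u j))) m).symm))
  refine Finset.sum_congr rfl fun i hi =>
    (Finset.sum_subset (Finset.range_mono (Nat.sub_le _ _)) fun j _ hj => ?_).symm
  refine coeff_of_lt_order n (lt_of_lt_of_le (Nat.cast_lt.mpr ?_)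
    (le_order_smul_pow_mul_map hΘ hΞ hD _ _ i j))
  simp only [Finset.mem_range] at hi hj
  omega

theorem formalExp_mul_eq_mul_formalExp {Θ Ξ y : A⟦X⟧} (hΘ : constantCoeff Θ = 0)
    (hΞ : constantCoeff Ξ = 0) (h : Θ * y = y * Ξ) :
    formalExp K Θ * y = y * formalExp K Ξ := by
  have pow_mul (k : ℕ) : Θ ^ k * y = y * Ξ ^ k :=
    ((show SemiconjBy y Ξ Θ from h.symm).pow_right k).symm
  ext n
  set E := ∑ k ∈ Finset.range (n + 1), ((k.factorial : K)⁻¹) • Θ ^ k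
  set F := ∑ k ∈ Finset.range (n + 1), ((k.factorial : K)⁻¹) • Ξ ^ k
  have truncated : E * y = y * F := by
    simp only [E, F, Finset.sum_mul, Finset.mul_sum, smul_mul_assoc, mul_smul_comm, pow_mul]
  have split : formalExp K Θ * y - y * formalExp K Ξ =
      (formalExp K Θ - E) * y + y * (F - formalExp K Ξ) := by
    rw [sub_mul, mul_sub, truncated]
    abel
  rw [← sub_eq_zero, ← map_sub, split]
  refine coeff_of_lt_order n (lt_of_lt_of_le (Nat.cast_lt.mpr n.lt_succ_self)
    ((le_min ?_ ?_).trans (min_order_le_order_add _ _)))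
  · exact (le_order_formalExp_sub hΘ _).trans (le_self_add.trans (le_order_mul _ _))
  · rw [← neg_sub, mul_neg, order_neg]
    exact (le_order_formalExp_sub hΞ _).trans (le_add_self.trans (le_order_mul _ _))

variable [CharZero K]

theorem sum_antidiagonal_smul_pow_mul_smul_pow {R : Type*} [Ring R] [Algebra K R] {x y : R}
    (h : Commute x y) (m : ℕ) :
    ∑ p ∈ antidiagonal m,
        (((p.1.factorial : K)⁻¹) • x ^ p.1) * (((p.2.factorial : K)⁻¹) • y ^ p.2) =
      ((m.factorial : K)⁻¹) • (x + y) ^ m := by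
  rw [h.add_pow', Finset.smul_sum]
  refine Finset.sum_congr rfl fun p hp => ?_
  obtain rfl := Finset.HasAntidiagonal.mem_antidiagonal.mp hp
  rw [smul_mul_smul_comm, ← Nat.cast_smul_eq_nsmul K, smul_smul, Nat.cast_add_choose]
  congr 1
  have factorial_ne_zero : ((p.1 + p.2).factorial : K) ≠ 0 := mod_cast (p.1 + p.2).factorial_ne_zero
  field_simp

theorem formalExp_add {Θ Ξ : A⟦X⟧} (h : Commute Θ Ξ) (hΘ : constantCoeff Θ = 0)
    (hΞ : constantCoeff Ξ = 0) :
    formalExp K (Θ + Ξ) = formalExp K Θ * formalExp K Ξ := by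
  ext n
  have := coeff_formalExp_mul_map_formalExp (K := K) hΘ hΞ (D := 1) (fun a => le_rfl) n
  simp only [Module.End.one_apply, sum_antidiagonal_smul_pow_mul_smul_pow h] at this
  rw [this, formalExp, coeff_mk]
  rfl

theorem formalExp_mul_formalExp_neg {Θ : A⟦X⟧} (hΘ : constantCoeff Θ = 0) :
    formalExp K Θ * formalExp K (-Θ) = 1 := by
  rw [← formalExp_add (Commute.refl Θ).neg_right hΘ (by rw [map_neg, hΘ, neg_zero]),
    add_neg_cancel, formalExp_zero]

theorem formalExp_neg_mul_formalExp {Θ : A⟦X⟧} (hΘ : constantCoeff Θ = 0) :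
    formalExp K (-Θ) * formalExp K Θ = 1 := by
  simpa using formalExp_mul_formalExp_neg (K := K) (Θ := -Θ) (by rw [map_neg, hΘ, neg_zero])

end FormalExp

section Coefficients

open PowerSeries

variable {R A : Type*} [CommRing R] [Ring A] [Algebra R A]

theorem mul_mem_coeffsIn {J : Ideal A} (a : A⟦X⟧) {b : A⟦X⟧} (hb : b ∈ coeffsIn J) :
    a * b ∈ coeffsIn J := fun n => by
  rw [coeff_mul]
  exact J.sum_mem fun p _ => J.mul_mem_left _ (hb _)

theorem lie_mem_coeffsIn {S : LieSubalgebra R A} {a b : A⟦X⟧}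
    (ha : a ∈ coeffsIn S.toSubmodule) (hb : b ∈ coeffsIn S.toSubmodule) :
    a * b - b * a ∈ coeffsIn S.toSubmodule := fun n => by
  rw [map_sub, coeff_mul, coeff_mul, ← Finset.Nat.sum_antidiagonal_swap (n := n),
    ← Finset.sum_sub_distrib]
  exact sum_mem fun p _ => by
    simpa only [Prod.fst_swap, Prod.snd_swap, LieSubalgebra.mem_toSubmodule,
      LieRing.of_associative_ring_bracket]
      using S.lie_mem (ha p.2) (hb p.1)

theorem coeff_euler (n : ℕ) (a : A⟦X⟧) : coeff n (euler R a) = n • coeff n a :=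
  coeff_mk n fun n => n • coeff n a

theorem euler_mul (a b : A⟦X⟧) : euler R (a * b) = euler R a * b + a * euler R b := by
  ext n
  rw [map_add, coeff_euler, coeff_mul, coeff_mul, coeff_mul, Finset.smul_sum,
    ← Finset.sum_add_distrib]
  refine Finset.sum_congr rfl fun p hp => ?_
  rw [coeff_euler, coeff_euler, ← Finset.HasAntidiagonal.mem_antidiagonal.mp hp, add_smul,
    smul_mul_assoc, mul_smul_comm]

@[simp]
theorem euler_one : euler R (1 : A⟦X⟧) = 0 := by
  simpa using euler_mul (R := R) (1 : A⟦X⟧) 1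

theorem le_order_euler (a : A⟦X⟧) : a.order ≤ (euler R a).order :=
  le_order _ _ fun n hn => by rw [coeff_euler, coeff_of_lt_order n hn, smul_zero]

theorem euler_mem_coeffsIn {M : Type*} [Semiring M] [Module M A] {S : Submodule M A} {a : A⟦X⟧}
    (h : a ∈ coeffsIn S) : euler R a ∈ coeffsIn S := fun n => by
  rw [coeff_euler]
  exact S.nsmul_mem (h n) n

theorem eq_C_of_euler_eq_zero [IsAddTorsionFree A] {a : A⟦X⟧} (h : euler R a = 0) :
    a = C (constantCoeff a) := by
  ext n
  rw [coeff_C]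
  split_ifs with hn
  · rw [hn, coeff_zero_eq_constantCoeff]
  · have : n • coeff n a = 0 := by rw [← coeff_euler (R := R), h, map_zero]
    exact (nsmul_eq_zero_iff_right hn).mp this

end Coefficients

section LogarithmicDerivative

open PowerSeries
open Finset.HasAntidiagonal (antidiagonal)

variable {K : Type*} [Field K] {A : Type*} [Ring A] [Algebra K A] {S : LieSubalgebra K A}

theorem exists_ad_pow_mulLeft_eq {x y : A⟦X⟧} (hx : x ∈ coeffsIn S.toSubmodule)
    (hy : y ∈ coeffsIn S.toSubmodule) (m : ℕ) :
    ∃ z ∈ coeffsIn S.toSubmodule,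
      (LieAlgebra.ad K (Module.End K A⟦X⟧) (LinearMap.mulLeft K x) ^ m) (LinearMap.mulLeft K y) =
        LinearMap.mulLeft K z := by
  induction m with
  | zero => exact ⟨y, hy, rfl⟩
  | succ m ih =>
    obtain ⟨z, hz, h⟩ := ih
    refine ⟨x * z - z * x, lie_mem_coeffsIn hx hz, ?_⟩
    rw [pow_succ', Module.End.mul_apply, h]
    ext1 a
    simp [LieRing.of_associative_ring_bracket, sub_mul, mul_assoc]

variable [CharZero K]

theorem sum_antidiagonal_smul_pow_mul_mul_smul_neg_pow {R : Type*} [Ring R] [Algebra K R] (x D : R)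
    (m : ℕ) :
    ∑ p ∈ antidiagonal m,
        (((p.1.factorial : K)⁻¹) • x ^ p.1) * D * (((p.2.factorial : K)⁻¹) • (-x) ^ p.2) =
      ((m.factorial : K)⁻¹) • (LieAlgebra.ad K R x ^ m) D := by
  have commute : Commute (LinearMap.mulLeft K x : Module.End K R) (LinearMap.mulRight K (-x)) :=
    LinearMap.commute_mulLeft_right x (-x)
  have ad_eq : LieAlgebra.ad K R x = LinearMap.mulLeft K x + LinearMap.mulRight K (-x) := by
    ext y
    simp [LieRing.of_associative_ring_bracket, sub_eq_add_neg]
  rw [ad_eq, ← LinearMap.smul_apply, ← sum_antidiagonal_smul_pow_mul_smul_pow commute,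
    LinearMap.sum_apply]
  simp [LinearMap.pow_mulLeft, LinearMap.pow_mulRight, mul_assoc]

theorem formalExp_mul_map_formalExp_neg_mem {x : A⟦X⟧} (hx : constantCoeff x = 0)
    {D : Module.End K A⟦X⟧} (hD : ∀ a, a.order ≤ (D a).order) {S : Submodule K A}
    (h : ∀ m, (LieAlgebra.ad K (Module.End K A⟦X⟧) (LinearMap.mulLeft K x) ^ m) D 1 ∈ coeffsIn S) :
    formalExp K x * D (formalExp K (-x)) ∈ coeffsIn S := by
  intro n
  rw [coeff_formalExp_mul_map_formalExp hx (by rw [map_neg, hx, neg_zero]) hD]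
  refine sum_mem fun m _ => ?_
  have conj := LinearMap.congr_fun (sum_antidiagonal_smul_pow_mul_mul_smul_neg_pow (K := K)
    (LinearMap.mulLeft K x : Module.End K A⟦X⟧) D m) 1
  have mulLeft_neg : -LinearMap.mulLeft K x = LinearMap.mulLeft K (-x) := by
    ext1
    simp
  rw [LinearMap.sum_apply, mulLeft_neg] at conj
  simp only [LinearMap.pow_mulLeft, Module.End.mul_apply, LinearMap.smul_apply,
    LinearMap.mulLeft_apply, mul_one] at conj
  simp only [smul_mul_assoc, conj]
  exact S.smul_mem _ (h m n)

theorem formalExp_conj_mem {x y : A⟦X⟧} (hx : x ∈ coeffsIn S.toSubmodule)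
    (hx0 : constantCoeff x = 0) (hy : y ∈ coeffsIn S.toSubmodule) :
    formalExp K x * y * formalExp K (-x) ∈ coeffsIn S.toSubmodule := by
  rw [mul_assoc]
  refine formalExp_mul_map_formalExp_neg_mem hx0 (D := LinearMap.mulLeft K y)
    (fun a => le_add_self.trans (le_order_mul _ _)) fun m => ?_
  obtain ⟨z, hz, h⟩ := exists_ad_pow_mulLeft_eq hx hy m
  rwa [h, LinearMap.mulLeft_apply, mul_one]

theorem formalExp_mul_euler_formalExp_neg_mem {x : A⟦X⟧} (hx : x ∈ coeffsIn S.toSubmodule)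
    (hx0 : constantCoeff x = 0) :
    formalExp K x * euler K (formalExp K (-x)) ∈ coeffsIn S.toSubmodule := by
  refine formalExp_mul_map_formalExp_neg_mem hx0 le_order_euler fun m => ?_
  cases m with
  | zero => simp
  | succ m =>
    have commutator : LieAlgebra.ad K (Module.End K A⟦X⟧) (LinearMap.mulLeft K x) (euler K) =
        LinearMap.mulLeft K (-euler K x) := by
      ext1 a
      simp [LieRing.of_associative_ring_bracket, euler_mul]
    obtain ⟨z, hz, h⟩ := exists_ad_pow_mulLeft_eq hx (neg_mem (euler_mem_coeffsIn (R := K) hx)) m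
    rw [pow_succ, Module.End.mul_apply, commutator, h]
    simpa using hz

/-- The exponential of a power series without constant term, as a unit. -/
noncomputable def formalExpUnit (K : Type*) [Field K] [CharZero K] [Algebra K A] (x : A⟦X⟧)
    (hx : constantCoeff x = 0) : A⟦X⟧ˣ where
  val := formalExp K x
  inv := formalExp K (-x)
  val_inv := formalExp_mul_formalExp_neg hx
  inv_val := formalExp_neg_mul_formalExp hx

/-- The group of invertible power series over an associative algebra which integrates a Lie
subalgebra `S`: conjugation by them preserves the power series with coefficients in `S`, and their
logarithmic derivative has coefficients in `S`. -/
noncomputable def formalLieGroup (S : LieSubalgebra K A) : Subgroup A⟦X⟧ˣ where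
  carrier := {W | euler K W.1 * W⁻¹.1 ∈ coeffsIn S.toSubmodule ∧
    ∀ y, W.1 * y * W⁻¹.1 ∈ coeffsIn S.toSubmodule ↔ y ∈ coeffsIn S.toSubmodule}
  one_mem' := by simp
  mul_mem' {V W} hV hW := by
    have conj (y) : (V * W).1 * y * (V * W)⁻¹.1 = V.1 * (W.1 * y * W⁻¹.1) * V⁻¹.1 := by
      simp [mul_assoc]
    have log : euler K (V * W).1 * (V * W)⁻¹.1 =
        euler K V.1 * V⁻¹.1 + V.1 * (euler K W.1 * W⁻¹.1) * V⁻¹.1 := by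
      rw [Units.val_mul, euler_mul, add_mul]
      simp [mul_assoc]
    refine ⟨?_, fun y => by rw [conj, hV.2, hW.2]⟩
    rw [log]
    exact add_mem hV.1 ((hV.2 _).mpr hW.1)
  inv_mem' {W} hW := by
    have conj (y) : W.1 * (W⁻¹.1 * y * W.1) * W⁻¹.1 = y := by simp [mul_assoc]
    refine ⟨?_, fun y => by rw [inv_inv, ← hW.2, conj]⟩
    have log : W.1 * (euler K W⁻¹.1 * W.1) * W⁻¹.1 = -(euler K W.1 * W⁻¹.1) := by
      have := euler_mul (R := K) W.1 W⁻¹.1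
      rw [W.mul_inv, euler_one] at this
      rw [mul_assoc, mul_assoc, W.mul_inv, mul_one]
      exact eq_neg_of_add_eq_zero_right this.symm
    rw [inv_inv, ← hW.2, log]
    exact neg_mem hW.1

theorem formalExpUnit_mem_formalLieGroup {x : A⟦X⟧} (hx : x ∈ coeffsIn S.toSubmodule)
    (hx0 : constantCoeff x = 0) : formalExpUnit K x hx0 ∈ formalLieGroup S := by
  have log : euler K (formalExp K x) * formalExp K (-x) =
      -(formalExp K x * euler K (formalExp K (-x))) := by
    rw [eq_neg_iff_add_eq_zero, ← euler_mul, formalExp_mul_formalExp_neg hx0, euler_one]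
  have conj (y : A⟦X⟧) :
      formalExp K (-x) * (formalExp K x * y * formalExp K (-x)) * formalExp K x = y := by
    rw [mul_assoc, mul_assoc _ _ (formalExp K x), formalExp_neg_mul_formalExp hx0, mul_one,
      ← mul_assoc, formalExp_neg_mul_formalExp hx0, one_mul]
  refine ⟨?_, fun y => ⟨fun hy => ?_, formalExp_conj_mem hx hx0⟩⟩
  · change euler K (formalExp K x) * formalExp K (-x) ∈ _
    rw [log]
    exact neg_mem (formalExp_mul_euler_formalExp_neg_mem hx hx0)
  · have := formalExp_conj_mem (neg_mem hx) (by rw [map_neg, hx0, neg_zero]) hy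
    rw [neg_neg] at this
    rwa [← conj y]

theorem formalLieGroup.eq_of_sub_mem {J : Ideal A} (hSJ : ∀ x ∈ S, x ∈ J → x = 0)
    {V W : A⟦X⟧ˣ} (hV : V ∈ formalLieGroup S) (hW : W ∈ formalLieGroup S)
    (h0 : constantCoeff V.1 = constantCoeff W.1) (h : V.1 - W.1 ∈ coeffsIn J) : V = W := by
  set Q := W⁻¹ * V with hQ
  have quotient_mem : Q.1 - 1 ∈ coeffsIn J := by
    have : Q.1 - 1 = W⁻¹.1 * (V.1 - W.1) := by simp [hQ, mul_sub]
    rw [this]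
    exact mul_mem_coeffsIn _ h
  set w := euler K Q.1 * Q⁻¹.1 with hw
  have euler_eq : euler K Q.1 = w * Q.1 := by simp [hw, mul_assoc]
  have log_mem : w ∈ coeffsIn J := by
    have : w = euler K (Q.1 - 1) - w * (Q.1 - 1) := by
      rw [map_sub, euler_one, euler_eq, mul_sub, mul_one]
      abel
    rw [this]
    exact sub_mem (euler_mem_coeffsIn quotient_mem) (mul_mem_coeffsIn _ quotient_mem)
  have log_eq_zero : w = 0 := by
    ext n
    exact hSJ _ (((formalLieGroup S).mul_mem (inv_mem hW) hV).1 n) (log_mem n)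
  have : IsAddTorsionFree A := .of_isTorsionFree K A
  have Q_eq : Q = 1 := by
    ext1
    rw [eq_C_of_euler_eq_zero (R := K) (a := Q.1) (by rw [euler_eq, log_eq_zero, zero_mul]),
      hQ, Units.val_mul, map_mul, h0, ← map_mul, Units.inv_mul, map_one, map_one, Units.val_one]
  exact (inv_mul_eq_one.mp Q_eq).symm

theorem formalExp_mul_formalExp_eq_of_sub_mem {J : Ideal A} (hSJ : ∀ x ∈ S, x ∈ J → x = 0)
    {x x' y y' : A⟦X⟧} (hx : x ∈ coeffsIn S.toSubmodule) (hx' : x' ∈ coeffsIn S.toSubmodule)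
    (hy : y ∈ coeffsIn S.toSubmodule) (hy' : y' ∈ coeffsIn S.toSubmodule)
    (hx0 : constantCoeff x = 0) (hx'0 : constantCoeff x' = 0) (hy0 : constantCoeff y = 0)
    (hy'0 : constantCoeff y' = 0)
    (h : formalExp K x * formalExp K x' - formalExp K y * formalExp K y' ∈ coeffsIn J) :
    formalExp K x * formalExp K x' = formalExp K y * formalExp K y' := by
  refine congrArg Units.val (formalLieGroup.eq_of_sub_mem hSJ
    (V := formalExpUnit K x hx0 * formalExpUnit K x' hx'0)
    (W := formalExpUnit K y hy0 * formalExpUnit K y' hy'0)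
    (mul_mem (formalExpUnit_mem_formalLieGroup hx hx0) (formalExpUnit_mem_formalLieGroup hx' hx'0))
    (mul_mem (formalExpUnit_mem_formalLieGroup hy hy0) (formalExpUnit_mem_formalLieGroup hy' hy'0))
    ?_ h)
  simp [formalExpUnit, constantCoeff_formalExp]

end LogarithmicDerivative

/-! ### Relations in the enveloping algebra of the semidirect sum -/

section Relations

open UniversalEnvelopingAlgebra

variable {K L : Type*} [CommRing K] [LieRing L] [LieAlgebra K L] (ρ : L →ₗ⁅K⁆ Module.End K L)

theorem lie_genH_genH (x y : L) : ⁅genH ρ x, genH ρ y⁆ = genH ρ ⁅x, y⁆ := by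
  change ⁅ι K _, ι K _⁆ = ι K (LieAlgebra.SemiDirectSum.inr (dualAction ρ) ⁅x, y⁆)
  rw [LieHom.map_lie, LieHom.map_lie]
  rfl

theorem commute_genX (ξ η : Module.Dual K L) : Commute (genX ρ ξ) (genX ρ η) := by
  have h : ⁅LieAlgebra.SemiDirectSum.inl (dualAction ρ) (AbelianDual.ofDual K L ξ),
      LieAlgebra.SemiDirectSum.inl (dualAction ρ) (AbelianDual.ofDual K L η)⁆ = 0 := by
    rw [← LieHom.map_lie, AbelianDual.lie_eq_zero, map_zero]
  have := congrArg (ι K) h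
  rwa [LieHom.map_lie, map_zero, LieRing.of_associative_ring_bracket, sub_eq_zero] at this

theorem lie_genH_genX (x : L) (ξ : Module.Dual K L) :
    ⁅genH ρ x, genX ρ ξ⁆ = -genX ρ (ξ ∘ₗ ρ x) := by
  have h : ⁅LieAlgebra.SemiDirectSum.inr (dualAction ρ) x,
      LieAlgebra.SemiDirectSum.inl (dualAction ρ) (AbelianDual.ofDual K L ξ)⁆ =
      -LieAlgebra.SemiDirectSum.inl (dualAction ρ) (AbelianDual.ofDual K L (ξ ∘ₗ ρ x)) := by
    rw [← map_neg]
    simp only [LieAlgebra.SemiDirectSum.inr_eq_mk, LieAlgebra.SemiDirectSum.inl_eq_mk,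
      LieAlgebra.SemiDirectSum.lie_eq_mk]
    congr 1
    · simp
      rfl
    · simp
  have := congrArg (ι K) h
  rwa [LieHom.map_lie, map_neg] at this

theorem comul_genX (ξ : Module.Dual K L) :
    Coalgebra.comul (R := K) (genX ρ ξ) = genX ρ ξ ⊗ₜ[K] 1 + 1 ⊗ₜ[K] genX ρ ξ :=
  comulHom_ι K _ _

theorem comul_genH (x : L) :
    Coalgebra.comul (R := K) (genH ρ x) = genH ρ x ⊗ₜ[K] 1 + 1 ⊗ₜ[K] genH ρ x :=
  comulHom_ι K _ _

theorem counit_genX (ξ : Module.Dual K L) : Coalgebra.counit (R := K) (genX ρ ξ) = 0 :=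
  counitHom_ι K _ _

theorem counit_genH (x : L) : Coalgebra.counit (R := K) (genH ρ x) = 0 :=
  counitHom_ι K _ _

end Relations

section AffineRep

variable {K L : Type*} [CommRing K]

/-- The projection `(w, c) ↦ (0, c)` of `L × K`. -/
def originProj (K L : Type*) [CommRing K] [AddCommGroup L] [Module K L] : Module.End K (L × K) :=
  LinearMap.inr K L K ∘ₗ LinearMap.snd K L K

/-- The infinitesimal translation `(w, c) ↦ (c v, 0)` of `L × K`; the affine space `L` is encoded
as the hyperplane `c = 1`. -/
def translationEnd (K : Type*) {L : Type*} [CommRing K] [AddCommGroup L] [Module K L] :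
    L →ₗ[K] Module.End K (L × K) where
  toFun v := LinearMap.inl K L K ∘ₗ (LinearMap.snd K L K).smulRight v
  map_add' v w := by ext <;> simp
  map_smul' c v := by ext <;> simp

theorem originProj_apply [AddCommGroup L] [Module K L] (w : L × K) :
    originProj K L w = (0, w.2) := rfl

theorem translationEnd_apply [AddCommGroup L] [Module K L] (v : L) (w : L × K) :
    translationEnd K v w = (w.2 • v, 0) := rfl

variable [LieRing L] [LieAlgebra K L]

/-- The affine representation `x ↦ (w ↦ ρ(x) w + D x)` of a Lie algebra defined by a linear
representation `ρ` and a 1-cocycle `D`, realised on `L × K`. -/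
def affineRep (ρ : L →ₗ⁅K⁆ Module.End K L) (D : L →ₗ[K] L)
    (hD : ∀ x y, D ⁅x, y⁆ = ρ x (D y) - ρ y (D x)) : L →ₗ⁅K⁆ Module.End K (L × K) where
  toFun x := LinearMap.inl K L K ∘ₗ ρ x ∘ₗ LinearMap.fst K L K + translationEnd K (D x)
  map_add' x y := by
    simp only [map_add, LinearMap.add_comp, LinearMap.comp_add]
    abel
  map_smul' c x := by
    simp only [map_smul, LinearMap.smul_comp, LinearMap.comp_smul, smul_add, RingHom.id_apply]
  map_lie' {x y} := by
    refine LinearMap.ext fun w => Prod.ext ?_ ?_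
    · simp [LieRing.of_associative_ring_bracket, translationEnd_apply, hD]
      abel
    · simp [LieRing.of_associative_ring_bracket, translationEnd_apply]

variable (ρ : L →ₗ⁅K⁆ Module.End K L) (D : L →ₗ[K] L)
    (hD : ∀ x y, D ⁅x, y⁆ = ρ x (D y) - ρ y (D x))

theorem affineRep_apply (x : L) (w : L × K) :
    affineRep ρ D hD x w = (ρ x w.1 + w.2 • D x, 0) := by
  simp [affineRep, translationEnd_apply]

theorem affineRep_mul_translationEnd (x v : L) :
    affineRep ρ D hD x * translationEnd K v = translationEnd K (ρ x v) := by
  refine LinearMap.ext fun w => ?_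
  simp [affineRep_apply, translationEnd_apply]

/-- The representation of `U(L ▷ L*)` in which `L` acts by the affine representation and `L*` by
zero. -/
noncomputable def affineUHom : USemidirect ρ →ₐ[K] Module.End K (L × K) :=
  UniversalEnvelopingAlgebra.lift K
    ((affineRep ρ D hD).comp (LieAlgebra.SemiDirectSum.projr (dualAction ρ)))

theorem affineUHom_genH (x : L) : affineUHom ρ D hD (genH ρ x) = affineRep ρ D hD x :=
  UniversalEnvelopingAlgebra.lift_ι_apply _ _ _

end AffineRep

/-! ### Exponents of twisting elements -/

section Exponent

open PowerSeries

variable {K : Type*} [CommRing K] {A B : Type*} [Ring A] [Algebra K A] [Ring B] [Algebra K B]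

@[simp]
theorem coeff_extend (g : A →ₐ[K] B) (a : A⟦X⟧) (n : ℕ) :
    coeff n (extend g a) = g (coeff n a) := rfl

@[simp]
theorem extend_C (g : A →ₐ[K] B) (a : A) : extend g (C a) = C (g a) :=
  PowerSeries.map_C _ a

@[simp]
theorem extend_X (g : A →ₐ[K] B) : extend g (X : A⟦X⟧) = X :=
  PowerSeries.map_X _

theorem constantCoeff_extend_eq_zero (g : A →ₐ[K] B) {a : A⟦X⟧} (ha : constantCoeff a = 0) :
    constantCoeff (extend g a) = 0 := by
  rw [← coeff_zero_eq_constantCoeff_apply] at ha ⊢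
  rw [coeff_extend, ha, map_zero]

variable {ι : Type*}

theorem map_freeAlgebra_lift (g : A →ₐ[K] B) (x : ι → A) (a : FreeAlgebra K ι) :
    g (FreeAlgebra.lift K x a) = FreeAlgebra.lift K (g ∘ x) a := by
  rw [← AlgHom.comp_apply]
  congr 1
  ext
  simp

theorem lift_mem_of_forall_mem (S : Subalgebra K A) {x : ι → A} (hx : ∀ i, x i ∈ S)
    (a : FreeAlgebra K ι) : FreeAlgebra.lift K x a ∈ S := by
  have h := (FreeAlgebra.lift K x).mem_range_self a
  rw [← Algebra.adjoin_range_eq_range_freeAlgebra_lift] at h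
  exact Algebra.adjoin_le (Set.range_subset_iff.mpr hx) h

theorem commute_lift {y : A} {x : ι → A} (h : ∀ i, Commute y (x i)) (a : FreeAlgebra K ι) :
    Commute y (FreeAlgebra.lift K x a) :=
  (Subalgebra.mem_centralizer_iff K).mp (lift_mem_of_forall_mem (Subalgebra.centralizer K {y})
    (fun i => (Subalgebra.mem_centralizer_iff K).mpr (by rintro _ rfl; exact h i)) a) y rfl

variable [Fintype ι]

/-- The series `-∑ ν, f ν (x) h ν`, the exponent of a twisting element. The formal power series
`f ν` is encoded as a series of noncommutative polynomials, so that it can be evaluated at any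
family `x` of elements of an algebra. -/
noncomputable def twistExponent (f : ι → (FreeAlgebra K ι)⟦X⟧) (x h : ι → A) : A⟦X⟧ :=
  -∑ ν, extend (FreeAlgebra.lift K x) (f ν) * C (h ν)

variable (f : ι → (FreeAlgebra K ι)⟦X⟧)

theorem coeff_twistExponent (x h : ι → A) (n : ℕ) : coeff n (twistExponent f x h) =
    -∑ ν, FreeAlgebra.lift K x (coeff n (f ν)) * h ν := by
  simp [twistExponent]

theorem extend_twistExponent (g : A →ₐ[K] B) (x h : ι → A) :
    extend g (twistExponent f x h) = twistExponent f (g ∘ x) (g ∘ h) := by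
  ext n
  simp [coeff_twistExponent, map_freeAlgebra_lift]

theorem constantCoeff_twistExponent {f : ι → (FreeAlgebra K ι)⟦X⟧}
    (hf : ∀ ν, constantCoeff (f ν) = 0) (x h : ι → A) :
    constantCoeff (twistExponent f x h) = 0 := by
  simp [twistExponent, constantCoeff_extend_eq_zero _ (hf _)]

theorem twistExponent_add (x h h' : ι → A) :
    twistExponent f x (h + h') = twistExponent f x h + twistExponent f x h' := by
  simp only [twistExponent, Pi.add_apply, map_add, mul_add, Finset.sum_add_distrib, neg_add]

@[simp]
theorem twistExponent_zero (x : ι → A) : twistExponent f x 0 = 0 := by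
  simp [twistExponent]

theorem twistExponent_mem_coeffsIn (S : Subalgebra K A) (N : Submodule K A) {x h : ι → A}
    (hx : ∀ i, x i ∈ S) (hh : ∀ ν, h ν ∈ N) :
    twistExponent f x h ∈ coeffsIn (Subalgebra.toSubmodule S * N) := by
  intro n
  rw [coeff_twistExponent]
  exact neg_mem (sum_mem fun ν _ =>
    Submodule.mul_mem_mul (lift_mem_of_forall_mem S hx _) (hh ν))

theorem twistExponent_mul_C {y : A} {x h h' : ι → A} (hx : ∀ i, Commute y (x i))
    (hh : ∀ ν, h ν * y = y * h' ν) :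
    twistExponent f x h * C y = C y * twistExponent f x h' := by
  ext n
  simp only [coeff_mul_C, coeff_C_mul, coeff_twistExponent, neg_mul, mul_neg, Finset.sum_mul,
    Finset.mul_sum]
  congr! 2 with ν
  rw [mul_assoc, hh, ← mul_assoc, ← mul_assoc, (commute_lift hx _).eq]

theorem commute_twistExponent {x h x' h' : ι → A} (hxx : ∀ i j, Commute (x i) (x' j))
    (hxh : ∀ i j, Commute (x i) (h' j)) (hhx : ∀ i j, Commute (h i) (x' j))
    (hhh : ∀ i j, Commute (h i) (h' j)) :
    Commute (twistExponent f x h) (twistExponent f x' h') := by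
  have key (m n : ℕ) :
      Commute (coeff m (twistExponent f x h)) (coeff n (twistExponent f x' h')) := by
    rw [coeff_twistExponent, coeff_twistExponent]
    refine .neg_left (.neg_right ?_)
    refine .sum_left _ _ _ fun ν _ => .sum_right _ _ _ fun μ _ => ?_
    refine .mul_left (.mul_right ?_ ?_) (.mul_right (commute_lift (hhx ν) _) (hhh ν μ))
    · exact commute_lift (fun j => (commute_lift (fun i => (hxx i j).symm) _).symm) _
    · exact (commute_lift (fun i => (hxh i μ).symm) _).symm
  ext n
  rw [coeff_mul, coeff_mul, ← Finset.Nat.sum_antidiagonal_swap]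
  exact Finset.sum_congr rfl fun p _ => key _ _

end Exponent

section Evaluation

variable {K ι Q : Type*} [Field K] [Ring Q] [Algebra K Q]

/-- The evaluation of a polynomial with coefficients in `Q` at a point of `K^ι`. -/
noncomputable def evalTensor (y : ι → K) : MvPolynomial ι K ⊗[K] Q →ₐ[K] Q :=
  (Algebra.TensorProduct.lid K Q).toAlgHom.comp
    (Algebra.TensorProduct.map (MvPolynomial.aeval y) (AlgHom.id K Q))

theorem evalTensor_tmul (y : ι → K) (r : MvPolynomial ι K) (q : Q) :
    evalTensor y (r ⊗ₜ[K] q) = MvPolynomial.eval y r • q := by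
  simp [evalTensor]

theorem eq_of_forall_evalTensor_eq [Infinite K] {s t : MvPolynomial ι K ⊗[K] Q}
    (h : ∀ y : ι → K, evalTensor y s = evalTensor y t) : s = t := by
  let v := Module.Basis.ofVectorSpace K Q
  let w := Algebra.TensorProduct.basis (MvPolynomial ι K) v
  have eval_repr (y : ι → K) (u : MvPolynomial ι K ⊗[K] Q) (i) :
      MvPolynomial.eval y (w.repr u i) = v.repr (evalTensor y u) i := by
    induction u with
    | zero => simp
    | add a b ha hb => simp only [map_add, Finsupp.add_apply, ha, hb]
    | tmul r q => simp [w, evalTensor_tmul]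
  refine w.repr.injective (Finsupp.ext fun i => MvPolynomial.funext fun y => ?_)
  rw [eval_repr, eval_repr, h]

variable {B : Type*} [Ring B] [Algebra K B]

open scoped IsMulCommutative in
theorem exists_algHom_aeval_eq {x : ι → B} (hx : ∀ i j, Commute (x i) (x j)) :
    ∃ γ : MvPolynomial ι K →ₐ[K] B, ∀ i, γ (MvPolynomial.X i) = x i := by
  let S : Subalgebra K B := Algebra.adjoin K (Set.range x)
  have : IsMulCommutative S := Algebra.isMulCommutative_adjoin K (by
    rintro _ ⟨i, rfl⟩ _ ⟨j, rfl⟩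
    exact hx i j)
  let x' (i : ι) : S := ⟨x i, Algebra.subset_adjoin ⟨i, rfl⟩⟩
  exact ⟨S.val.comp (MvPolynomial.aeval x'), fun i => congrArg S.val (MvPolynomial.aeval_X x' i)⟩

theorem exists_algHom_tensor_eq {x : ι → B} (hx : ∀ i j, Commute (x i) (x j)) (β : Q →ₐ[K] B)
    (hβ : ∀ i q, Commute (x i) (β q)) :
    ∃ Γ : MvPolynomial ι K ⊗[K] Q →ₐ[K] B,
      (∀ i, Γ (MvPolynomial.X i ⊗ₜ[K] 1) = x i) ∧ ∀ q, Γ (1 ⊗ₜ[K] q) = β q := by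
  obtain ⟨γ, hγ⟩ := exists_algHom_aeval_eq (K := K) hx
  have hγβ (r : MvPolynomial ι K) (q : Q) : Commute (γ r) (β q) := by
    induction r using MvPolynomial.induction_on with
    | C a =>
      rw [← MvPolynomial.algebraMap_eq, γ.commutes]
      exact Algebra.commutes a (β q)
    | add r r' hr hr' => simpa only [map_add] using hr.add_left hr'
    | mul_X r i hr => simpa only [map_mul, hγ] using hr.mul_left (hβ i q)
  refine ⟨Algebra.TensorProduct.lift γ β hγβ, fun i => ?_, fun q => ?_⟩ <;> simp [hγ]

end Evaluation

section TranslatesOrigin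

open PowerSeries

variable {K ι Q B : Type*} [Field K] [Fintype ι] [Ring Q] [Algebra K Q] [Ring B] [Algebra K B]

/-- The exponentials of the elements `-∑ ν, f ν (T y) α ν` of an algebra `Q` map `p` to
`p - T ∑ i, y i • E i` for all `y : ι → K`. When `Q` consists of endomorphisms of an affine space
and `p` is the projection to the origin, this says that `f` are the coordinates in which the orbit
map of the origin is minus the identity. -/
def TranslatesOrigin (f : ι → (FreeAlgebra K ι)⟦X⟧) (α : ι → Q) (p : Q) (E : ι → Q) : Prop :=
  ∀ y : ι → K, formalExp K (twistExponent f (fun i => algebraMap K Q (y i)) α) * C p =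
    C p - X * C (∑ i, y i • E i)

variable [CharZero K] {f : ι → (FreeAlgebra K ι)⟦X⟧} {α : ι → Q} {p : Q} {E : ι → Q}

theorem TranslatesOrigin.generic (h : TranslatesOrigin f α p E) :
    formalExp K (twistExponent f (fun i => (MvPolynomial.X i : MvPolynomial ι K) ⊗ₜ[K] (1 : Q))
        (fun ν => 1 ⊗ₜ[K] α ν)) * C (1 ⊗ₜ[K] p) =
      C (1 ⊗ₜ[K] p) - X * C (∑ i, (MvPolynomial.X i : MvPolynomial ι K) ⊗ₜ[K] E i) := by
  ext n
  refine eq_of_forall_evalTensor_eq fun y => ?_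
  rw [← coeff_extend, ← coeff_extend]
  congr 1
  simpa [extend_formalExp, extend_twistExponent, Function.comp_def, evalTensor_tmul,
    ← Algebra.algebraMap_eq_smul_one] using h y

theorem TranslatesOrigin.map (h : TranslatesOrigin f α p E) (β : Q →ₐ[K] B) {x : ι → B}
    (hx : ∀ i j, Commute (x i) (x j)) (hβ : ∀ i q, Commute (x i) (β q)) :
    formalExp K (twistExponent f x (β ∘ α)) * C (β p) =
      C (β p) - X * C (∑ i, x i * β (E i)) := by
  obtain ⟨Γ, hΓx, hΓβ⟩ := exists_algHom_tensor_eq hx β hβ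
  have hΓ (i : ι) (q : Q) : Γ (MvPolynomial.X i ⊗ₜ[K] q) = x i * β q := by
    rw [← hΓx, ← hΓβ, ← map_mul, Algebra.TensorProduct.tmul_mul_tmul, mul_one, one_mul]
  simpa [extend_formalExp, extend_twistExponent, Function.comp_def, hΓ, hΓx, hΓβ] using
    congrArg (extend Γ) h.generic

theorem TranslatesOrigin.of_algEquiv (e : Q ≃ₐ[K] B)
    (h : TranslatesOrigin f (e ∘ α) (e p) (e ∘ E)) : TranslatesOrigin f α p E := by
  intro y
  simpa [Function.comp_def, ← Algebra.smul_def] using h.map (e.symm : B →ₐ[K] Q)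
    (fun i j => Algebra.commutes (y i) (algebraMap K Q (y j)))
    (fun i q => Algebra.commutes (y i) (e.symm q))

theorem TranslatesOrigin.map_add (h : TranslatesOrigin f α p E) (β : Q →ₐ[K] B) {x₁ x₂ : ι → B}
    (hx₁ : ∀ i j, Commute (x₁ i) (x₁ j)) (hx₂ : ∀ i j, Commute (x₂ i) (x₂ j))
    (hx₁₂ : ∀ i j, Commute (x₁ i) (x₂ j)) (hβ₁ : ∀ i q, Commute (x₁ i) (β q))
    (hβ₂ : ∀ i q, Commute (x₂ i) (β q)) :
    formalExp K (twistExponent f (x₁ + x₂) (β ∘ α)) * C (β p) =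
      C (β p) - X * C (∑ i, x₁ i * β (E i)) - X * C (∑ i, x₂ i * β (E i)) := by
  rw [h.map β (x := x₁ + x₂) (fun i j => ((hx₁ i j).add_right (hx₁₂ i j)).add_left
    ((hx₁₂ j i).symm.add_right (hx₂ i j))) fun i q => (hβ₁ i q).add_left (hβ₂ i q)]
  simp only [Pi.add_apply, add_mul, Finset.sum_add_distrib, _root_.map_add, mul_add, ← sub_sub]

/-- Both sides are the composite of the translations by `-∑ x₁ i * β (E i)` and
`-∑ x₂ i * β (E i)`, up to the right factor `exp (-∑ f ν (x₁) h ν)`, by which the second translation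
is conjugated on the right hand side. -/
theorem TranslatesOrigin.twist_congruence (h : TranslatesOrigin f α p E)
    (hf : ∀ ν, constantCoeff (f ν) = 0) (β : Q →ₐ[K] B) {x₁ x₂ k : ι → B}
    (hx₁ : ∀ i j, Commute (x₁ i) (x₁ j)) (hx₂ : ∀ i j, Commute (x₂ i) (x₂ j))
    (hx₁₂ : ∀ i j, Commute (x₁ i) (x₂ j)) (hβ₁ : ∀ i q, Commute (x₁ i) (β q))
    (hβ₂ : ∀ i q, Commute (x₂ i) (β q)) (hk₁ : ∀ i j, Commute (x₁ i) (k j))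
    (hkβ : ∀ i q, Commute (k i) (β q))
    (hinv : ∀ ν, (k ν + β (α ν)) * ∑ i, x₂ i * β (E i) = (∑ i, x₂ i * β (E i)) * k ν) :
    formalExp K (twistExponent f (x₁ + x₂) (β ∘ α)) * formalExp K (twistExponent f x₁ k) *
        C (β p) =
      formalExp K (twistExponent f x₁ (k + β ∘ α)) * formalExp K (twistExponent f x₂ (β ∘ α)) *
        C (β p) := by
  have h0 (x h : ι → B) : constantCoeff (twistExponent f x h) = 0 :=
    constantCoeff_twistExponent hf x h
  set Ω₁ := ∑ i, x₁ i * β (E i)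
  set Ω₂ := ∑ i, x₂ i * β (E i)
  set e := formalExp K (twistExponent f x₁ k)
  set e₁ := formalExp K (twistExponent f x₁ (β ∘ α))
  have e_mul_p : e * C (β p) = C (β p) * e :=
    formalExp_mul_eq_mul_formalExp (h0 _ _) (h0 _ _)
      (twistExponent_mul_C f (fun i => (hβ₁ i p).symm) fun ν => (hkβ ν p).eq)
  have exp_add : formalExp K (twistExponent f x₁ (k + β ∘ α)) = e₁ * e := by
    rw [add_comm, twistExponent_add, formalExp_add _ (h0 _ _) (h0 _ _)]
    exact commute_twistExponent f hx₁ hk₁ (fun i j => (hβ₁ j _).symm) fun i j => (hkβ j _).symm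
  have exp_mul_Ω₂ : e₁ * e * C Ω₂ = C Ω₂ * e := by
    rw [← exp_add]
    refine formalExp_mul_eq_mul_formalExp (h0 _ _) (h0 _ _) (twistExponent_mul_C f ?_ hinv)
    exact fun i => .sum_left _ _ _ fun j _ => ((hx₁₂ i j).mul_right (hβ₁ i _)).symm
  have translate₁ : e₁ * C (β p) = C (β p) - X * C Ω₁ := h.map β hx₁ hβ₁
  have translate₂ : formalExp K (twistExponent f x₂ (β ∘ α)) * C (β p) = C (β p) - X * C Ω₂ :=
    h.map β hx₂ hβ₂
  have translate₁₂ : formalExp K (twistExponent f (x₁ + x₂) (β ∘ α)) * C (β p) =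
      C (β p) - X * C Ω₁ - X * C Ω₂ := h.map_add β hx₁ hx₂ hx₁₂ hβ₁ hβ₂
  calc _ = (C (β p) - X * C Ω₁ - X * C Ω₂) * e := by
        rw [mul_assoc, e_mul_p, ← mul_assoc, translate₁₂]
    _ = e₁ * (C (β p) * e) - X * (C Ω₂ * e) := by
        rw [sub_mul, ← mul_assoc, translate₁, mul_assoc]
    _ = e₁ * e * (C (β p) - X * C Ω₂) := by
        rw [← e_mul_p, ← exp_mul_Ω₂, mul_sub, (commute_X (e₁ * e)).left_comm, ← mul_assoc]
    _ = _ := by rw [exp_add, mul_assoc (e₁ * e), translate₂]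

end TranslatesOrigin

section MulLieSubalgebra

variable {K A : Type*} [CommRing K] [Ring A] [Algebra K A]

theorem lie_mem_adjoin {s : Set A} {n : A} (h : ∀ a ∈ s, ⁅n, a⁆ ∈ Algebra.adjoin K s) {c : A}
    (hc : c ∈ Algebra.adjoin K s) : ⁅n, c⁆ ∈ Algebra.adjoin K s := by
  simp only [LieRing.of_associative_ring_bracket] at h ⊢
  induction hc using Algebra.adjoin_induction with
  | mem x hx => exact h x hx
  | algebraMap r =>
    rw [Algebra.commutes, sub_self]
    exact zero_mem _
  | add x y _ _ hx hy =>
    convert add_mem hx hy using 1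
    noncomm_ring
  | mul x y hx' hy' hx hy =>
    convert add_mem (mul_mem hx hy') (mul_mem hx' hy) using 1
    noncomm_ring

theorem lie_mem_mul {C : Subalgebra K A} {N : LieSubalgebra K A}
    (hC : ∀ c ∈ C, ∀ c' ∈ C, Commute c c') (hNC : ∀ n ∈ N, ∀ c ∈ C, ⁅n, c⁆ ∈ C) {x y : A}
    (hx : x ∈ Subalgebra.toSubmodule C * N.toSubmodule)
    (hy : y ∈ Subalgebra.toSubmodule C * N.toSubmodule) :
    ⁅x, y⁆ ∈ Subalgebra.toSubmodule C * N.toSubmodule := by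
  induction hx using Submodule.mul_induction_on' with
  | add x _ x' _ hx hx' =>
    rw [add_lie]
    exact add_mem hx hx'
  | mem_mul_mem c hc n hn =>
    induction hy using Submodule.mul_induction_on' with
    | add y _ y' _ hy hy' =>
      rw [lie_add]
      exact add_mem hy hy'
    | mem_mul_mem c' hc' n' hn' =>
      have expand : ⁅c * n, c' * n'⁆ =
          c * c' * ⁅n, n'⁆ + c * ⁅n, c'⁆ * n' - c' * ⁅n', c⁆ * n + (c * c' - c' * c) * n' * n := by
        simp only [LieRing.of_associative_ring_bracket]
        noncomm_ring
      rw [expand, (hC c hc c' hc').eq, sub_self, zero_mul, zero_mul, add_zero]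
      refine sub_mem (add_mem ?_ ?_) ?_
      · exact Submodule.mul_mem_mul (C.mul_mem hc' hc) (N.lie_mem hn hn')
      · exact Submodule.mul_mem_mul (C.mul_mem hc (hNC n hn c' hc')) hn'
      · exact Submodule.mul_mem_mul (C.mul_mem hc' (hNC n' hn' c hc)) hn

/-- The Lie algebra `C N` spanned by the products of elements of a commutative subalgebra `C` and of
a Lie algebra `N` that normalizes `C`. -/
def mulLieSubalgebra (C : Subalgebra K A) (N : LieSubalgebra K A)
    (hC : ∀ c ∈ C, ∀ c' ∈ C, Commute c c') (hNC : ∀ n ∈ N, ∀ c ∈ C, ⁅n, c⁆ ∈ C) :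
    LieSubalgebra K A where
  __ := Subalgebra.toSubmodule C * N.toSubmodule
  lie_mem' := lie_mem_mul hC hNC

end MulLieSubalgebra

section Legs

variable {K A B C Q : Type*} [CommRing K] [Ring A] [Algebra K A] [Ring B] [Algebra K B]
  [Ring C] [Algebra K C] [Ring Q] [Algebra K Q]

/-- The embedding `a ↦ a ⊗ 1 ⊗ 1`. -/
noncomputable def leg₁ : A →ₐ[K] A ⊗[K] (B ⊗[K] C) := Algebra.TensorProduct.includeLeft

/-- The embedding `b ↦ 1 ⊗ b ⊗ 1`. -/
noncomputable def leg₂ : B →ₐ[K] A ⊗[K] (B ⊗[K] C) :=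
  Algebra.TensorProduct.includeRight.comp Algebra.TensorProduct.includeLeft

/-- The embedding `c ↦ 1 ⊗ 1 ⊗ c`. -/
noncomputable def leg₃ : C →ₐ[K] A ⊗[K] (B ⊗[K] C) :=
  Algebra.TensorProduct.includeRight.comp Algebra.TensorProduct.includeRight

/-- The homomorphism `id ⊗ id ⊗ α`. -/
noncomputable def mapThird (α : C →ₐ[K] Q) : A ⊗[K] (B ⊗[K] C) →ₐ[K] A ⊗[K] (B ⊗[K] Q) :=
  Algebra.TensorProduct.map (AlgHom.id K A) (Algebra.TensorProduct.map (AlgHom.id K B) α)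

theorem leg₁_apply (a : A) : (leg₁ a : A ⊗[K] (B ⊗[K] C)) = a ⊗ₜ 1 := rfl

theorem leg₂_apply (b : B) : (leg₂ b : A ⊗[K] (B ⊗[K] C)) = 1 ⊗ₜ (b ⊗ₜ 1) := rfl

theorem leg₃_apply (c : C) : (leg₃ c : A ⊗[K] (B ⊗[K] C)) = 1 ⊗ₜ (1 ⊗ₜ c) := rfl

theorem commute_leg₁_leg₂ (a : A) (b : B) : Commute (leg₁ a : A ⊗[K] (B ⊗[K] C)) (leg₂ b) := by
  simp [Commute, SemiconjBy, leg₁_apply, leg₂_apply]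

theorem commute_leg₁_leg₃ (a : A) (c : C) : Commute (leg₁ a : A ⊗[K] (B ⊗[K] C)) (leg₃ c) := by
  simp [Commute, SemiconjBy, leg₁_apply, leg₃_apply]

theorem commute_leg₂_leg₃ (b : B) (c : C) : Commute (leg₂ b : A ⊗[K] (B ⊗[K] C)) (leg₃ c) := by
  simp [Commute, SemiconjBy, leg₂_apply, leg₃_apply]

theorem mapThird_leg₁ (α : C →ₐ[K] Q) (a : A) :
    mapThird α (leg₁ a : A ⊗[K] (B ⊗[K] C)) = leg₁ a := by
  simp [mapThird, leg₁_apply]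

theorem mapThird_leg₂ (α : C →ₐ[K] Q) (b : B) :
    mapThird α (leg₂ b : A ⊗[K] (B ⊗[K] C)) = leg₂ b := by
  simp [mapThird, leg₂_apply]

theorem mapThird_leg₃ (α : C →ₐ[K] Q) (c : C) :
    mapThird α (leg₃ c : A ⊗[K] (B ⊗[K] C)) = leg₃ (α c) := by
  simp [mapThird, leg₃_apply]

end Legs

/-- The tensor cube of an algebra, with the association used for twisting cocycles. -/
abbrev TensorCube (K H : Type*) [CommRing K] [Ring H] [Algebra K H] : Type _ := H ⊗[K] (H ⊗[K] H)

section TwistSeries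

open PowerSeries

variable {K L ι : Type*} [Field K] [LieRing L] [LieAlgebra K L] [Fintype ι]
  (ρ : L →ₗ⁅K⁆ Module.End K L) (b : Module.Basis ι K L) (f : ι → (FreeAlgebra K ι)⟦X⟧)

/-- `exp(-∑ ν, f ν(X) ⊗ H_ν)`, where the series `f ν` in noncommuting variables are evaluated at the
basis of `L*` that is dual to `b`. -/
noncomputable def twistSeries : (USemidirect ρ ⊗[K] USemidirect ρ)⟦X⟧ :=
  formalExp K (twistExponent f (fun i => genX ρ (b.coord i) ⊗ₜ 1) fun ν => 1 ⊗ₜ genH ρ (b ν))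

theorem extend_twistSeries {A : Type*} [Ring A] [Algebra K A]
    (g : USemidirect ρ ⊗[K] USemidirect ρ →ₐ[K] A) :
    extend g (twistSeries ρ b f) = formalExp K (twistExponent f
      (fun i => g (genX ρ (b.coord i) ⊗ₜ 1)) fun ν => g (1 ⊗ₜ genH ρ (b ν))) := by
  rw [twistSeries, extend_formalExp, extend_twistExponent]
  rfl

theorem extend_comulLeft_twistSeries :
    extend comulLeft (twistSeries ρ b f) = formalExp K (twistExponent f
      ((fun i => leg₁ (genX ρ (b.coord i))) + fun i => leg₂ (genX ρ (b.coord i)))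
      fun ν => leg₃ (genH ρ (b ν))) := by
  rw [extend_twistSeries]
  congr 2 <;> funext i <;> simp [comulLeft, leg₁_apply, leg₂_apply, leg₃_apply, comul_genX,
    TensorProduct.add_tmul, Algebra.TensorProduct.one_def]

theorem extend_embed₁₂_twistSeries :
    extend embed₁₂ (twistSeries ρ b f) = formalExp K (twistExponent f
      (fun i => (leg₁ (genX ρ (b.coord i)) : TensorCube K (USemidirect ρ)))
      fun ν => leg₂ (genH ρ (b ν))) := by
  rw [extend_twistSeries]
  rfl

theorem extend_comulRight_twistSeries :
    extend comulRight (twistSeries ρ b f) = formalExp K (twistExponent f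
      (fun i => (leg₁ (genX ρ (b.coord i)) : TensorCube K (USemidirect ρ)))
      ((fun ν => leg₂ (genH ρ (b ν))) + fun ν => leg₃ (genH ρ (b ν)))) := by
  rw [extend_twistSeries]
  congr 2 <;> funext i <;> simp [comulRight, leg₁_apply, leg₂_apply, leg₃_apply, comul_genH,
    TensorProduct.tmul_add]

theorem extend_embed₂₃_twistSeries :
    extend embed₂₃ (twistSeries ρ b f) = formalExp K (twistExponent f
      (fun i => leg₂ (genX ρ (b.coord i))) fun ν => leg₃ (genH ρ (b ν))) := by
  rw [extend_twistSeries]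
  rfl

/-- The commutative algebra generated by `L* ⊗ 1 ⊗ 1` and `1 ⊗ L* ⊗ 1`. -/
noncomputable def legsX :
    Subalgebra K (TensorCube K (USemidirect ρ)) :=
  Algebra.adjoin K (Set.range (leg₁ ∘ genX ρ) ∪ Set.range (leg₂ ∘ genX ρ))

theorem leg₁_genX_mem_legsX (ξ : Module.Dual K L) : leg₁ (genX ρ ξ) ∈ legsX ρ :=
  Algebra.subset_adjoin (Or.inl ⟨ξ, rfl⟩)

theorem leg₂_genX_mem_legsX (ξ : Module.Dual K L) : leg₂ (genX ρ ξ) ∈ legsX ρ :=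
  Algebra.subset_adjoin (Or.inr ⟨ξ, rfl⟩)

/-- The Lie algebra `1 ⊗ L ⊗ 1 + 1 ⊗ 1 ⊗ L`. -/
noncomputable def legsH :
    LieSubalgebra K (TensorCube K (USemidirect ρ)) where
  __ := LinearMap.range (leg₂.toLinearMap ∘ₗ genH ρ) ⊔ LinearMap.range (leg₃.toLinearMap ∘ₗ genH ρ)
  lie_mem' {n n'} hn hn' := by
    obtain ⟨_, ⟨x, rfl⟩, _, ⟨y, rfl⟩, rfl⟩ := Submodule.mem_sup.mp hn
    obtain ⟨_, ⟨x', rfl⟩, _, ⟨y', rfl⟩, rfl⟩ := Submodule.mem_sup.mp hn'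
    refine Submodule.mem_sup.mpr ⟨_, ⟨⁅x, x'⁆, rfl⟩, _, ⟨⁅y, y'⁆, rfl⟩, ?_⟩
    have h₂₃ := (commute_leg₂_leg₃ (K := K) (A := USemidirect ρ) (genH ρ x) (genH ρ y')).eq
    have h₃₂ := (commute_leg₂_leg₃ (K := K) (A := USemidirect ρ) (genH ρ x') (genH ρ y)).eq
    simp only [LinearMap.comp_apply, AlgHom.toLinearMap_apply, ← lie_genH_genH,
      LieRing.of_associative_ring_bracket, map_sub, map_mul, mul_add, add_mul, h₂₃, h₃₂]
    abel

theorem mem_legsH {n : TensorCube K (USemidirect ρ)} :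
    n ∈ legsH ρ ↔ ∃ x y, leg₂ (genH ρ x) + leg₃ (genH ρ y) = n := by
  refine Submodule.mem_sup.trans ⟨?_, ?_⟩
  · rintro ⟨_, ⟨x, rfl⟩, _, ⟨y, rfl⟩, rfl⟩
    exact ⟨x, y, rfl⟩
  · rintro ⟨x, y, rfl⟩
    exact ⟨_, ⟨x, rfl⟩, _, ⟨y, rfl⟩, rfl⟩

theorem leg₂_genH_mem_legsH (x : L) : leg₂ (genH ρ x) ∈ legsH ρ :=
  (mem_legsH ρ).mpr ⟨x, 0, by simp⟩

theorem leg₃_genH_mem_legsH (x : L) : leg₃ (genH ρ x) ∈ legsH ρ :=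
  (mem_legsH ρ).mpr ⟨0, x, by simp⟩

theorem commute_of_mem_legsX :
    ∀ c ∈ legsX ρ, ∀ c' ∈ legsX ρ, Commute c c' := by
  have : IsMulCommutative (legsX ρ) := Algebra.isMulCommutative_adjoin K (by
    rintro _ (⟨ξ, rfl⟩ | ⟨ξ, rfl⟩) _ (⟨η, rfl⟩ | ⟨η, rfl⟩)
    · exact (commute_genX ρ ξ η).map leg₁
    · exact commute_leg₁_leg₂ _ _
    · exact (commute_leg₁_leg₂ _ _).symm
    · exact (commute_genX ρ ξ η).map leg₂)
  exact fun c hc c' hc' => congrArg Subtype.val (mul_comm' (⟨c, hc⟩ : legsX ρ) ⟨c', hc'⟩)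

theorem lie_mem_legsX : ∀ n ∈ legsH ρ, ∀ c ∈ legsX ρ, ⁅n, c⁆ ∈ legsX ρ := by
  intro n hn c hc
  obtain ⟨x, y, rfl⟩ := (mem_legsH ρ).mp hn
  refine lie_mem_adjoin ?_ hc
  rintro _ (⟨ξ, rfl⟩ | ⟨ξ, rfl⟩)
  · have : ⁅(leg₂ (genH ρ x) + leg₃ (genH ρ y) : TensorCube K (USemidirect ρ)),
        (leg₁ (genX ρ ξ) : TensorCube K (USemidirect ρ))⁆ = 0 :=
      ((commute_leg₁_leg₂ (genX ρ ξ) _).add_right (commute_leg₁_leg₃ _ _)).symm.lie_eq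
    rw [Function.comp_apply, this]
    exact zero_mem _
  · have : ⁅(leg₂ (genH ρ x) + leg₃ (genH ρ y) : TensorCube K (USemidirect ρ)),
        (leg₂ (genX ρ ξ) : TensorCube K (USemidirect ρ))⁆ = leg₂ (genX ρ (-(ξ ∘ₗ ρ x))) := by
      have h₂₃ := commute_leg₂_leg₃ (K := K) (A := USemidirect ρ) (genX ρ ξ) (genH ρ y)
      rw [add_lie, h₂₃.symm.lie_eq, add_zero, map_neg, ← lie_genH_genX]
      simp only [LieRing.of_associative_ring_bracket, map_sub, map_mul]
    rw [Function.comp_apply, this]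
    exact leg₂_genX_mem_legsX ρ _

/-- The Lie algebra that contains the exponents of both sides of the twist identity. -/
noncomputable def legsLie :
    LieSubalgebra K (TensorCube K (USemidirect ρ)) :=
  mulLieSubalgebra (legsX ρ) (legsH ρ) (commute_of_mem_legsX ρ) (lie_mem_legsX ρ)

theorem mem_range_embed₁₂_of_mem_legsX {c : TensorCube K (USemidirect ρ)}
    (hc : c ∈ legsX ρ) : c ∈ (embed₁₂ (K := K) (H := USemidirect ρ)).range := by
  refine Algebra.adjoin_le ?_ hc
  rintro _ (⟨ξ, rfl⟩ | ⟨ξ, rfl⟩)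
  · exact ⟨genX ρ ξ ⊗ₜ 1, by simp [embed₁₂, leg₁_apply, Algebra.TensorProduct.one_def]⟩
  · exact ⟨1 ⊗ₜ genX ρ ξ, by simp [embed₁₂, leg₂_apply]⟩

variable {Q : Type*} [Ring Q] [Algebra K Q] {α : USemidirect ρ →ₐ[K] Q} {p : Q}

theorem eq_zero_of_mem_legsLie {σ : Q →ₗ[K] USemidirect ρ} (hσp : σ p = 1)
    (hσ : ∀ y, σ (α (genH ρ y) * p) = genH ρ y)
    {l : TensorCube K (USemidirect ρ)} (hl : l ∈ legsLie ρ)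
    (h : mapThird α l * leg₃ p = 0) : l = 0 := by
  let κ : USemidirect ρ ⊗[K] (USemidirect ρ ⊗[K] Q) →ₗ[K] _ :=
    TensorProduct.map LinearMap.id (TensorProduct.map LinearMap.id σ)
  suffices recover : κ (mapThird α l * leg₃ p) = l by rw [← recover, h, map_zero]
  clear h
  induction hl using Submodule.mul_induction_on' with
  | add x _ y _ hx hy => rw [map_add, add_mul, map_add, hx, hy]
  | mem_mul_mem c hc n hn =>
    obtain ⟨w, rfl⟩ := mem_range_embed₁₂_of_mem_legsX ρ hc
    obtain ⟨x, y, rfl⟩ := (mem_legsH ρ).mp hn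
    clear hc hn
    change κ (mapThird α (embed₁₂ w * _) * leg₃ p) = embed₁₂ w * _
    induction w with
    | zero => simp
    | add w w' h h' => simp only [map_add, add_mul] at h h' ⊢; rw [h, h']
    | tmul u v =>
      simp [embed₁₂, mapThird, leg₂_apply, leg₃_apply, κ, mul_add, add_mul, hσp, hσ]

end TwistSeries

section TwistIdentity

open PowerSeries

variable {K L ι Q : Type*} [Field K] [LieRing L] [LieAlgebra K L] [Fintype ι] [Ring Q]
  [Algebra K Q] {ρ : L →ₗ⁅K⁆ Module.End K L} (b : Module.Basis ι K L)

theorem sum_genX_coord_comp_tmul (E : L →ₗ[K] Q) (g : Module.End K L) :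
    ∑ i, genX ρ (b.coord i ∘ₗ g) ⊗ₜ[K] E (b i) = ∑ i, genX ρ (b.coord i) ⊗ₜ[K] E (g (b i)) := by
  have coord_comp (i : ι) : b.coord i ∘ₗ g = ∑ j, b.coord i (g (b j)) • b.coord j := by
    classical
    exact b.ext fun j => by simp [Finsupp.single_apply]
  have E_apply (j : ι) : E (g (b j)) = ∑ i, b.coord i (g (b j)) • E (b i) := by
    conv_lhs => rw [← b.sum_repr (g (b j))]
    simp only [map_sum, map_smul, Module.Basis.coord_apply]
  simp only [coord_comp, E_apply, map_sum, map_smul, TensorProduct.sum_tmul,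
    TensorProduct.tmul_sum, TensorProduct.smul_tmul]
  exact Finset.sum_comm

theorem leg_genH_mul_sum {α : USemidirect ρ →ₐ[K] Q} {E : L →ₗ[K] Q}
    (hE : ∀ x v, α (genH ρ x) * E v = E (ρ x v)) (x : L) :
    (leg₂ (genH ρ x) + leg₃ (α (genH ρ x)) : USemidirect ρ ⊗[K] (USemidirect ρ ⊗[K] Q)) *
        ∑ i, leg₂ (genX ρ (b.coord i)) * leg₃ (E (b i)) =
      (∑ i, leg₂ (genX ρ (b.coord i)) * leg₃ (E (b i))) * leg₂ (genH ρ x) := by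
  have h (ξ : Module.Dual K L) :
      genH ρ x * genX ρ ξ = genX ρ ξ * genH ρ x - genX ρ (ξ ∘ₗ ρ x) := by
    rw [sub_eq_add_neg, ← lie_genH_genX, LieRing.of_associative_ring_bracket]
    abel
  have move := congrArg (fun t : USemidirect ρ ⊗[K] Q => (1 : USemidirect ρ) ⊗ₜ[K] t)
    (sum_genX_coord_comp_tmul b E (ρ x))
  simp only [TensorProduct.tmul_sum] at move
  simp only [leg₂_apply, leg₃_apply, Algebra.TensorProduct.tmul_mul_tmul, one_mul, mul_one,
    Finset.mul_sum, Finset.sum_mul, add_mul, h, hE, TensorProduct.sub_tmul, TensorProduct.tmul_sub,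
    Finset.sum_add_distrib, Finset.sum_sub_distrib, move, sub_add_cancel]

variable {f : ι → (FreeAlgebra K ι)⟦X⟧}

theorem twistExponent_mem_legsLie {x h : ι → TensorCube K (USemidirect ρ)}
    (hx : ∀ i, x i ∈ legsX ρ) (hh : ∀ ν, h ν ∈ legsH ρ) :
    twistExponent f x h ∈ coeffsIn (legsLie ρ).toSubmodule :=
  twistExponent_mem_coeffsIn f (legsX ρ) (legsH ρ).toSubmodule hx hh

variable [CharZero K]

theorem twist_congruence_twistSeries (hf : ∀ ν, constantCoeff (f ν) = 0)
    {α : USemidirect ρ →ₐ[K] Q} {p : Q} {E : L →ₗ[K] Q}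
    (hE : ∀ x v, α (genH ρ x) * E v = E (ρ x v))
    (h : TranslatesOrigin f (fun ν => α (genH ρ (b ν))) p (E ∘ b)) :
    extend (mapThird α) (extend comulLeft (twistSeries ρ b f) *
        extend embed₁₂ (twistSeries ρ b f)) * C (leg₃ p) =
      extend (mapThird α) (extend comulRight (twistSeries ρ b f) *
        extend embed₂₃ (twistSeries ρ b f)) * C (leg₃ p) := by
  have commute_genX' (i j) : Commute (genX ρ (b.coord i)) (genX ρ (b.coord j)) :=
    commute_genX ρ _ _
  have := h.twist_congruence hf (B := USemidirect ρ ⊗[K] (USemidirect ρ ⊗[K] Q)) leg₃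
    (x₁ := fun i => leg₁ (genX ρ (b.coord i))) (x₂ := fun i => leg₂ (genX ρ (b.coord i)))
    (k := fun ν => leg₂ (genH ρ (b ν))) (fun i j => (commute_genX' i j).map leg₁)
    (fun i j => (commute_genX' i j).map leg₂) (fun _ _ => commute_leg₁_leg₂ _ _)
    (fun _ _ => commute_leg₁_leg₃ _ _) (fun _ _ => commute_leg₂_leg₃ _ _)
    (fun _ _ => commute_leg₁_leg₂ _ _) (fun _ _ => commute_leg₂_leg₃ _ _)
    fun ν => leg_genH_mul_sum b hE (b ν)
  simpa only [map_mul, extend_comulLeft_twistSeries, extend_embed₁₂_twistSeries,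
    extend_comulRight_twistSeries, extend_embed₂₃_twistSeries, extend_formalExp,
    extend_twistExponent, Function.comp_def, Pi.add_def, map_add, mapThird_leg₁,
    mapThird_leg₂, mapThird_leg₃] using this

theorem twist_twistSeries (hf : ∀ ν, constantCoeff (f ν) = 0)
    {α : USemidirect ρ →ₐ[K] Q} {p : Q} {E : L →ₗ[K] Q} {σ : Q →ₗ[K] USemidirect ρ}
    (hE : ∀ x v, α (genH ρ x) * E v = E (ρ x v)) (hσp : σ p = 1)
    (hσ : ∀ y, σ (α (genH ρ y) * p) = genH ρ y)
    (h : TranslatesOrigin f (fun ν => α (genH ρ (b ν))) p (E ∘ b)) :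
    extend comulLeft (twistSeries ρ b f) * extend embed₁₂ (twistSeries ρ b f) =
      extend comulRight (twistSeries ρ b f) * extend embed₂₃ (twistSeries ρ b f) := by
  let J : Ideal (TensorCube K (USemidirect ρ)) :=
    (Ideal.torsionOf _ _ (leg₃ p : USemidirect ρ ⊗[K] (USemidirect ρ ⊗[K] Q))).comap (mapThird α)
  have congruence : extend comulLeft (twistSeries ρ b f) * extend embed₁₂ (twistSeries ρ b f) -
      extend comulRight (twistSeries ρ b f) * extend embed₂₃ (twistSeries ρ b f) ∈ coeffsIn J := by
    intro n
    change mapThird α (coeff n _) * (leg₃ p : USemidirect ρ ⊗[K] (USemidirect ρ ⊗[K] Q)) = 0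
    rw [← coeff_extend, ← coeff_mul_C, map_sub, sub_mul,
      twist_congruence_twistSeries b hf hE h, sub_self, map_zero]
  have X₁ (i) := leg₁_genX_mem_legsX ρ (b.coord i)
  have X₂ (i) := leg₂_genX_mem_legsX ρ (b.coord i)
  have H₂ (ν) := leg₂_genH_mem_legsH ρ (b ν)
  have H₃ (ν) := leg₃_genH_mem_legsH ρ (b ν)
  have h0 (x h : ι → TensorCube K (USemidirect ρ)) : constantCoeff (twistExponent f x h) = 0 :=
    constantCoeff_twistExponent hf x h
  rw [extend_comulLeft_twistSeries, extend_embed₁₂_twistSeries,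
    extend_comulRight_twistSeries, extend_embed₂₃_twistSeries] at congruence ⊢
  exact formalExp_mul_formalExp_eq_of_sub_mem
    (fun l hl hlJ => eq_zero_of_mem_legsLie ρ hσp hσ hl hlJ)
    (twistExponent_mem_legsLie (fun i => add_mem (X₁ i) (X₂ i)) H₃)
    (twistExponent_mem_legsLie X₁ H₂)
    (twistExponent_mem_legsLie X₁ fun ν => add_mem (H₂ ν) (H₃ ν))
    (twistExponent_mem_legsLie X₂ H₃) (h0 _ _) (h0 _ _) (h0 _ _) (h0 _ _) congruence

end TwistIdentity

/-! ### Twisting cocycles from affine representations -/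

section Homogeneous

open PowerSeries

/-- The coefficient of degree `n` of a series in commuting variables, written as a noncommutative
polynomial, is homogeneous of degree `n`. -/
def IsHomogeneousSeries {K ι : Type*} [CommRing K] (f : (FreeAlgebra K ι)⟦X⟧) : Prop :=
  ∀ n, coeff n f ∈ Submodule.span K (Set.range (FreeAlgebra.ι K (X := ι))) ^ n

theorem IsHomogeneousSeries.lift_coeff_mem {K ι A : Type*} [CommRing K] [Ring A] [Algebra K A]
    {f : (FreeAlgebra K ι)⟦X⟧} (hf : IsHomogeneousSeries f) {S : Submodule K A} {x : ι → A}
    (hx : ∀ i, x i ∈ S) (n : ℕ) : FreeAlgebra.lift K x (coeff n f) ∈ S ^ n := by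
  have map_le : (Submodule.span K (Set.range (FreeAlgebra.ι K (X := ι)))).map
      (FreeAlgebra.lift K x).toLinearMap ≤ S := by
    rw [Submodule.map_span, Submodule.span_le]
    rintro _ ⟨_, ⟨i, rfl⟩, rfl⟩
    simpa using hx i
  refine pow_le_pow_left' map_le n ?_
  rw [← Submodule.map_pow]
  exact Submodule.mem_map_of_mem (hf n)

theorem map₂_mk_mul_map₂_mk {K A : Type*} [CommRing K] [Ring A] [Algebra K A]
    (S T S' T' : Submodule K A) :
    Submodule.map₂ (TensorProduct.mk K A A) S T * Submodule.map₂ (TensorProduct.mk K A A) S' T' ≤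
      Submodule.map₂ (TensorProduct.mk K A A) (S * S') (T * T') := by
  rw [Submodule.map₂_eq_span_image2 _ S T, Submodule.map₂_eq_span_image2 _ S' T',
    Submodule.span_mul_span, Submodule.span_le]
  rintro _ ⟨_, ⟨s, hs, t, ht, rfl⟩, _, ⟨s', hs', t', ht', rfl⟩, rfl⟩
  simp only [TensorProduct.mk_apply, Algebra.TensorProduct.tmul_mul_tmul, SetLike.mem_coe]
  exact Submodule.apply_mem_map₂ (TensorProduct.mk K A A) (Submodule.mul_mem_mul hs hs')
    (Submodule.mul_mem_mul ht ht')

theorem gradedMonoid_map₂_mk {K A : Type*} [CommRing K] [Ring A] [Algebra K A]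
    (S : Submodule K A) (T : Subalgebra K A) :
    SetLike.GradedMonoid fun n : ℕ =>
      Submodule.map₂ (TensorProduct.mk K A A) (S ^ n) (Subalgebra.toSubmodule T) where
  one_mem := Submodule.apply_mem_map₂ _ (pow_zero S ▸ Submodule.one_le.mp le_rfl) T.one_mem
  mul_mem m n _ _ ha hb := by
    have := map₂_mk_mul_map₂_mk (S ^ m) (Subalgebra.toSubmodule T) (S ^ n) _
      (Submodule.mul_mem_mul ha hb)
    rwa [← pow_add, (Subalgebra.isIdempotentElem_toSubmodule T).eq] at this

theorem coeff_formalExp_mem {K A : Type*} [Field K] [Ring A] [Algebra K A]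
    (M : ℕ → Submodule K A) [SetLike.GradedMonoid M] {Θ : A⟦X⟧} (h : ∀ n, coeff n Θ ∈ M n)
    (n : ℕ) : coeff n (formalExp K Θ) ∈ M n := by
  have coeff_pow_mem (k n : ℕ) : coeff n (Θ ^ k) ∈ M n := by
    induction k generalizing n with
    | zero =>
      rw [pow_zero, coeff_one]
      split_ifs with hn
      · exact hn ▸ SetLike.GradedOne.one_mem
      · exact zero_mem _
    | succ k ih =>
      rw [pow_succ, coeff_mul]
      refine sum_mem fun p hp => ?_
      exact Finset.HasAntidiagonal.mem_antidiagonal.mp hp ▸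
        SetLike.GradedMul.mul_mem (ih p.1) (h p.2)
  rw [formalExp, coeff_mk]
  exact sum_mem fun k _ => Submodule.smul_mem _ _ (coeff_pow_mem k n)

theorem map₂_le_tensorDegreePart {K L : Type*} [CommRing K] [LieRing L] [LieAlgebra K L]
    (ρ : L →ₗ⁅K⁆ Module.End K L) (n : ℕ) :
    Submodule.map₂ (TensorProduct.mk K (USemidirect ρ) (USemidirect ρ))
      (LinearMap.range (genX ρ) ^ n)
      (Subalgebra.toSubmodule (Algebra.adjoin K (Set.range (genH ρ)))) ≤
      tensorDegreePart (degreePart ρ) n := by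
  refine (Submodule.map₂_le_map₂ (p₂ := degreePart ρ n) (q₂ := degreePart ρ 0) ?_ ?_).trans ?_
  · exact fun x hx => mul_one x ▸ Submodule.mul_mem_mul hx (one_mem (Algebra.adjoin K _))
  · rw [degreePart, pow_zero, one_mul]
  · exact le_iSup₂_of_le (f := fun (p : ℕ × ℕ) (_ : p ∈ Finset.HasAntidiagonal.antidiagonal n) =>
      Submodule.map₂ (TensorProduct.mk K (USemidirect ρ) (USemidirect ρ)) (degreePart ρ p.1)
        (degreePart ρ p.2)) (n, 0) (by simp) le_rfl

end Homogeneous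

section TwistingCocycle

open PowerSeries

variable {K L ι : Type*} [Field K] [LieRing L] [LieAlgebra K L] [Fintype ι]
  (ρ : L →ₗ⁅K⁆ Module.End K L) (b : Module.Basis ι K L) {f : ι → (FreeAlgebra K ι)⟦X⟧}

theorem coeff_formalExp_mem_tensorDegreePart {Θ : (USemidirect ρ ⊗[K] USemidirect ρ)⟦X⟧}
    (hΘ : ∀ n, coeff n Θ ∈ Submodule.map₂ (TensorProduct.mk K (USemidirect ρ) (USemidirect ρ))
      (LinearMap.range (genX ρ) ^ n)
      (Subalgebra.toSubmodule (Algebra.adjoin K (Set.range (genH ρ))))) (n : ℕ) :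
    coeff n (formalExp K Θ) ∈ tensorDegreePart (degreePart ρ) n :=
  have := gradedMonoid_map₂_mk (LinearMap.range (genX ρ)) (Algebra.adjoin K (Set.range (genH ρ)))
  map₂_le_tensorDegreePart ρ n (coeff_formalExp_mem _ hΘ n)

theorem coeff_twistExponent_mem (hf : ∀ ν, IsHomogeneousSeries (f ν)) (n : ℕ) :
    coeff n (twistExponent f (fun i => genX ρ (b.coord i) ⊗ₜ[K] (1 : USemidirect ρ))
        fun ν => 1 ⊗ₜ genH ρ (b ν)) ∈
      Submodule.map₂ (TensorProduct.mk K (USemidirect ρ) (USemidirect ρ))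
        (LinearMap.range (genX ρ) ^ n)
        (Subalgebra.toSubmodule (Algebra.adjoin K (Set.range (genH ρ)))) := by
  rw [coeff_twistExponent]
  refine neg_mem (sum_mem fun ν _ => ?_)
  have lift_tmul (a : FreeAlgebra K ι) :
      FreeAlgebra.lift K (fun i => genX ρ (b.coord i) ⊗ₜ[K] (1 : USemidirect ρ)) a =
        FreeAlgebra.lift K (fun i => genX ρ (b.coord i)) a ⊗ₜ[K] 1 := by
    refine DFunLike.congr_fun (?_ : _ = (Algebra.TensorProduct.includeLeft :
      USemidirect ρ →ₐ[K] _).comp (FreeAlgebra.lift K fun i => genX ρ (b.coord i))) a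
    ext
    simp
  rw [lift_tmul, Algebra.TensorProduct.tmul_mul_tmul, mul_one, one_mul]
  exact Submodule.apply_mem_map₂ _ ((hf ν).lift_coeff_mem (fun i => LinearMap.mem_range_self _ _) n)
    (Algebra.subset_adjoin (Set.mem_range_self _))

theorem twistExponent_zero_left {A : Type*} [Ring A] [Algebra K A]
    (hf0 : ∀ ν, constantCoeff (f ν) = 0) (hf : ∀ ν, IsHomogeneousSeries (f ν)) (h : ι → A) :
    twistExponent f 0 h = 0 := by
  ext n
  rw [coeff_twistExponent, (coeff n).map_zero, neg_eq_zero]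
  refine Finset.sum_eq_zero fun ν _ => ?_
  rcases eq_or_ne n 0 with rfl | hn
  · rw [coeff_zero_eq_constantCoeff_apply, hf0, map_zero, zero_mul]
  · have mem_bot := (hf ν).lift_coeff_mem (A := A) (S := ⊥) (x := 0) (by simp) n
    rw [Submodule.bot_pow hn, Submodule.mem_bot] at mem_bot
    rw [mem_bot, zero_mul]

theorem extend_counitLeft_twistSeries (hf0 : ∀ ν, constantCoeff (f ν) = 0)
    (hf : ∀ ν, IsHomogeneousSeries (f ν)) : extend counitLeft (twistSeries ρ b f) = 1 := by
  have counit_eq_zero :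
      (fun i => counitLeft (genX ρ (b.coord i) ⊗ₜ[K] (1 : USemidirect ρ))) = 0 := by
    funext i
    simp [counitLeft, counit_genX]
  rw [extend_twistSeries, counit_eq_zero, twistExponent_zero_left hf0 hf, formalExp_zero]

theorem extend_counitRight_twistSeries : extend counitRight (twistSeries ρ b f) = 1 := by
  have counit_eq_zero : (fun ν => counitRight ((1 : USemidirect ρ) ⊗ₜ[K] genH ρ (b ν))) = 0 := by
    funext ν
    simp [counitRight, counit_genH]
  rw [extend_twistSeries, counit_eq_zero, twistExponent_zero, formalExp_zero]

variable [CharZero K] {ρ}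

theorem isTwistingCocycle_twistSeries (hf0 : ∀ ν, constantCoeff (f ν) = 0)
    (hf : ∀ ν, IsHomogeneousSeries (f ν)) {D : L ≃ₗ[K] L}
    (hD : ∀ x y, D ⁅x, y⁆ = ρ x (D y) - ρ y (D x))
    (h : TranslatesOrigin f (fun ν => affineUHom ρ D hD (genH ρ (b ν))) (originProj K L)
      (translationEnd K ∘ b)) :
    IsTwistingCocycle (degreePart ρ) (twistSeries ρ b f) where
  homogeneous := coeff_formalExp_mem_tensorDegreePart ρ (coeff_twistExponent_mem ρ b hf)
  invertible := by
    have hΘ := constantCoeff_twistExponent hf0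
      (fun i => genX ρ (b.coord i) ⊗ₜ[K] (1 : USemidirect ρ)) fun ν => 1 ⊗ₜ genH ρ (b ν)
    refine ⟨formalExp K (-_), coeff_formalExp_mem_tensorDegreePart ρ fun n => ?_,
      formalExp_mul_formalExp_neg hΘ, formalExp_neg_mul_formalExp hΘ⟩
    rw [map_neg]
    exact neg_mem (coeff_twistExponent_mem ρ b hf n)
  twist := by
    let evalOrigin : Module.End K (L × K) →ₗ[K] L × K := LinearMap.applyₗ (0, 1)
    refine twist_twistSeries b hf0 (α := affineUHom ρ D hD)
      (σ := (genH ρ ∘ₗ D.symm.toLinearMap).coprod (Algebra.linearMap K _) ∘ₗ evalOrigin)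
      (fun x v => ?_) ?_ (fun y => ?_) h
    · rw [affineUHom_genH, affineRep_mul_translationEnd]
    · simp [evalOrigin, originProj_apply]
    · simp [evalOrigin, affineUHom_genH, affineRep_apply, originProj_apply]
  counit_left := extend_counitLeft_twistSeries ρ b hf0 hf
  counit_right := extend_counitRight_twistSeries ρ b

end TwistingCocycle

/-! ### Asymptotic expansions -/

section Expansion

open PowerSeries Asymptotics Filter Finset

variable {𝕜 : Type*} [RCLike 𝕜] {A : Type*} [NormedRing A] [NormedAlgebra 𝕜 A]

/-- `∑ aₙ sⁿ` is the asymptotic expansion of `g s` at `s = 0`. It links the analytic exponential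
to the formal one. -/
def HasExpansion (g : 𝕜 → A) (a : A⟦X⟧) : Prop :=
  ∀ n, (fun s => g s - ∑ k ∈ range n, s ^ k • coeff k a) =O[𝓝 0] fun s => s ^ n

theorem isBigO_pow_pow_nhds_zero {m n : ℕ} (h : n ≤ m) :
    (fun s : 𝕜 => s ^ m) =O[𝓝 0] fun s => s ^ n := by
  obtain rfl | h := h.eq_or_lt
  · exact isBigO_refl _ _
  · exact (isLittleO_pow_pow h).isBigO

theorem eq_zero_of_pow_smul_isBigO {y : A} {n : ℕ}
    (h : (fun s : 𝕜 => s ^ n • y) =O[𝓝 0] fun s => s ^ (n + 1)) : y = 0 := by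
  have hO : (fun _ : 𝕜 => y) =O[𝓝[≠] 0] fun s => s := by
    refine ((isBigO_refl (fun s : 𝕜 => (s ^ n)⁻¹) (𝓝[≠] 0)).smul
      (h.mono nhdsWithin_le_nhds)).congr' ?_ ?_ <;>
      filter_upwards [self_mem_nhdsWithin] with s hs
    · exact inv_smul_smul₀ (pow_ne_zero n hs) y
    · rw [smul_eq_mul, pow_succ, inv_mul_cancel_left₀ (pow_ne_zero n hs)]
  exact tendsto_nhds_unique tendsto_const_nhds
    (hO.trans_tendsto (tendsto_id.mono_left nhdsWithin_le_nhds))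

theorem coeff_sum_range_monomial (a : A⟦X⟧) {k n : ℕ} (h : k < n) :
    coeff k (∑ i ∈ range n, monomial i (coeff i a)) = coeff k a := by
  simp [coeff_monomial, h]

namespace HasExpansion

theorem pow_smul (m : ℕ) (y : A) : HasExpansion (fun s : 𝕜 => s ^ m • y) (monomial m y) := by
  intro n
  simp only [coeff_monomial, smul_ite, smul_zero, Finset.sum_ite_eq', mem_range]
  by_cases h : m < n
  · simpa only [if_pos h, sub_self] using isBigO_zero _ _
  · simpa only [if_neg h, sub_zero, smul_eq_mul, mul_one] using
      (isBigO_pow_pow_nhds_zero (𝕜 := 𝕜) (not_lt.mp h)).smul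
        (isBigO_const_const y (one_ne_zero (α := 𝕜)) (𝓝 0))

theorem const (y : A) : HasExpansion (fun _ : 𝕜 => y) (C y) := by
  simpa using pow_smul (𝕜 := 𝕜) 0 y

theorem smul_const (y : A) : HasExpansion (fun s : 𝕜 => s • y) (X * C y) := by
  simpa only [pow_one, monomial_eq_C_mul_X_pow, (commute_X _).eq] using pow_smul (𝕜 := 𝕜) 1 y

variable {g h : 𝕜 → A} {a b : A⟦X⟧}

theorem add (hg : HasExpansion g a) (hh : HasExpansion h b) :
    HasExpansion (fun s => g s + h s) (a + b) := by
  intro n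
  refine ((hg n).add (hh n)).congr_left fun s => ?_
  simp only [map_add, smul_add, Finset.sum_add_distrib]
  abel

theorem const_smul (hg : HasExpansion g a) (c : 𝕜) :
    HasExpansion (fun s => c • g s) (c • a) := by
  intro n
  refine ((hg n).const_smul_left c).congr_left fun s => ?_
  simp only [Pi.smul_apply, coeff_smul, smul_sub, Finset.smul_sum, smul_comm c]

theorem neg (hg : HasExpansion g a) : HasExpansion (fun s => -g s) (-a) := by
  simpa using hg.const_smul (-1)

theorem sub (hg : HasExpansion g a) (hh : HasExpansion h b) :
    HasExpansion (fun s => g s - h s) (a - b) := by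
  simpa only [sub_eq_add_neg] using hg.add hh.neg

theorem sum {ι : Type*} (t : Finset ι) {g : ι → 𝕜 → A} {a : ι → A⟦X⟧}
    (h : ∀ i ∈ t, HasExpansion (g i) (a i)) :
    HasExpansion (fun s => ∑ i ∈ t, g i s) (∑ i ∈ t, a i) := by
  classical
  induction t using Finset.induction_on with
  | empty => simpa using const (𝕜 := 𝕜) (0 : A)
  | insert i t hi ih =>
    simp only [Finset.sum_insert hi]
    exact (h i (mem_insert_self i t)).add (ih fun j hj => h j (mem_insert_of_mem hj))

theorem congr (hg : HasExpansion g a) (e : g =ᶠ[𝓝 0] h) : HasExpansion h a :=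
  fun n => (hg n).congr' (e.sub .rfl) .rfl

theorem isBigO_one (hg : HasExpansion g a) : g =O[𝓝 0] fun _ => (1 : 𝕜) := by
  simpa using hg 0

theorem mul (hg : HasExpansion g a) (hh : HasExpansion h b) :
    HasExpansion (fun s => g s * h s) (a * b) := by
  intro n
  set P : 𝕜 → A := fun s => ∑ k ∈ range n, s ^ k • coeff k a
  set R : 𝕜 → A := fun s => ∑ k ∈ range n, s ^ k • coeff k b
  have P_isBigO_one : P =O[𝓝 0] fun _ => (1 : 𝕜) :=
    (show Continuous P by fun_prop).continuousAt.isBigO_one 𝕜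
  have sub_P : (fun s => (g s - P s) * h s) =O[𝓝 0] fun s : 𝕜 => s ^ n := by
    simpa using (hg n).mul hh.isBigO_one
  have sub_R : (fun s => P s * (h s - R s)) =O[𝓝 0] fun s : 𝕜 => s ^ n := by
    simpa using P_isBigO_one.mul (hh n)
  have expansion_PR : HasExpansion (fun s => P s * R s)
      ((∑ i ∈ range n, monomial i (coeff i a)) * ∑ j ∈ range n, monomial j (coeff j b)) := by
    simp only [P, R, Finset.sum_mul_sum, smul_mul_smul_comm, ← pow_add, monomial_mul_monomial]
    exact .sum _ fun i _ => .sum _ fun j _ => .pow_smul _ _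
  have PR_sub : (fun s => P s * R s - ∑ k ∈ range n, s ^ k • coeff k (a * b)) =O[𝓝 0]
      fun s : 𝕜 => s ^ n := by
    refine (expansion_PR n).congr_left fun s => ?_
    congr! 3 with k hk
    rw [coeff_mul, coeff_mul]
    refine Finset.sum_congr rfl fun p hp => ?_
    have hp := HasAntidiagonal.mem_antidiagonal.mp hp
    have hk := mem_range.mp hk
    rw [coeff_sum_range_monomial a (by lia), coeff_sum_range_monomial b (by lia)]
  refine ((sub_P.add sub_R).add PR_sub).congr_left fun s => ?_
  noncomm_ring

theorem pow (hg : HasExpansion g a) (n : ℕ) : HasExpansion (fun s => g s ^ n) (a ^ n) := by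
  induction n with
  | zero => simpa using const (𝕜 := 𝕜) (1 : A)
  | succ n ih => simpa only [pow_succ] using ih.mul hg

theorem eq_zero (h : HasExpansion (fun _ : 𝕜 => (0 : A)) a) : a = 0 := by
  ext n
  rw [map_zero]
  induction n using Nat.strong_induction_on with
  | _ n ih =>
    refine eq_zero_of_pow_smul_isBigO ((h (n + 1)).neg_left.congr_left fun s => ?_)
    rw [Finset.sum_range_succ, Finset.sum_eq_zero fun k hk => by rw [ih k (mem_range.mp hk),
      smul_zero]]
    simp

theorem unique (ha : HasExpansion g a) (hb : HasExpansion g b) : a = b :=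
  sub_eq_zero.mp ((ha.sub hb).congr (.of_forall fun s => sub_self (g s))).eq_zero

theorem exp [CompleteSpace A] (hg : HasExpansion g a) (ha : constantCoeff a = 0) :
    HasExpansion (fun s => NormedSpace.exp (g s)) (formalExp 𝕜 a) := by
  intro n
  have isBigO_id : g =O[𝓝 0] fun s : 𝕜 => s := by
    simpa [ha] using hg 1
  have exp_sub_partialSum : (fun s => NormedSpace.exp (g s) -
      ∑ k ∈ range n, ((k.factorial : 𝕜)⁻¹) • g s ^ k) =O[𝓝 0] fun s : 𝕜 => s ^ n := by
    have h := ((NormedSpace.exp_hasFPowerSeriesAt_zero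
      (𝕂 := 𝕜) (𝔸 := A)).isBigO_sub_partialSum_pow n).comp_tendsto
      (isBigO_id.trans_tendsto tendsto_id)
    refine (h.trans (isBigO_id.norm_left.pow n)).congr_left fun s => ?_
    simp [FormalMultilinearSeries.partialSum, NormedSpace.expSeries_apply_eq]
  have partialSum_expansion := HasExpansion.sum (range n)
    (fun k _ => (hg.pow k).const_smul ((k.factorial : 𝕜)⁻¹)) n
  refine (exp_sub_partialSum.add partialSum_expansion).congr_left fun s => ?_
  rw [sub_add_sub_cancel]
  congr! 3 with k hk
  exact (coeff_formalExp_of_lt ha (mem_range.mp hk)).symm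

end HasExpansion

end Expansion

/-! ### Taylor series -/

section Taylor

open PowerSeries Asymptotics Filter

variable {𝕜 : Type*} [RCLike 𝕜] {ι : Type*} [Fintype ι] [DecidableEq ι]

/-- The Taylor series at the origin of a function of several variables, as a series of
noncommutative polynomials: its part of degree `n` is
`(1/n!) ∑ ∂_{i₁} ⋯ ∂_{iₙ} F(0) X_{i₁} ⋯ X_{iₙ}`. -/
noncomputable def freeTaylor (F : (ι → 𝕜) → 𝕜) : (FreeAlgebra 𝕜 ι)⟦X⟧ :=
  PowerSeries.mk fun n => ((n.factorial : 𝕜)⁻¹) • ∑ i : Fin n → ι,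
    (iteratedFDeriv 𝕜 n F 0 fun k => Pi.single (i k) 1) •
      (List.ofFn fun k => FreeAlgebra.ι 𝕜 (i k)).prod

theorem lift_coeff_freeTaylor {A : Type*} [Ring A] [Algebra 𝕜 A] (F : (ι → 𝕜) → 𝕜) (n : ℕ)
    (x : ι → A) : FreeAlgebra.lift 𝕜 x (coeff n (freeTaylor F)) =
      ((n.factorial : 𝕜)⁻¹) • ∑ i : Fin n → ι,
        (iteratedFDeriv 𝕜 n F 0 fun k => Pi.single (i k) 1) •
          (List.ofFn fun k => x (i k)).prod := by
  simp [freeTaylor, map_list_prod, List.map_ofFn, Function.comp_def]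

theorem isHomogeneousSeries_freeTaylor (F : (ι → 𝕜) → 𝕜) :
    IsHomogeneousSeries (freeTaylor F) := by
  intro n
  rw [freeTaylor, coeff_mk]
  refine Submodule.smul_mem _ _ (sum_mem fun i _ => Submodule.smul_mem _ _ ?_)
  rw [Submodule.span_pow]
  exact Submodule.subset_span (Set.mem_pow.mpr ⟨fun k => ⟨_, i k, rfl⟩, rfl⟩)

theorem constantCoeff_freeTaylor {F : (ι → 𝕜) → 𝕜} (hF : F 0 = 0) :
    constantCoeff (freeTaylor F) = 0 := by
  rw [← coeff_zero_eq_constantCoeff_apply, freeTaylor, coeff_mk]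
  simp [hF]

theorem multilinear_const_eq_sum_single {n : ℕ}
    (m : ContinuousMultilinearMap 𝕜 (fun _ : Fin n => ι → 𝕜) 𝕜) (y : ι → 𝕜) :
    (m fun _ => y) = ∑ i : Fin n → ι, (m fun k => Pi.single (i k) 1) * ∏ k, y (i k) := by
  conv_lhs => rw [pi_eq_sum_univ' y]
  rw [m.map_sum]
  simp only [m.map_smul_univ, smul_eq_mul, mul_comm]

theorem lift_coeff_freeTaylor_algebraMap {A : Type*} [Ring A] [Algebra 𝕜 A]
    (F : (ι → 𝕜) → 𝕜) (n : ℕ) (y : ι → 𝕜) :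
    FreeAlgebra.lift 𝕜 (fun i => algebraMap 𝕜 A (y i)) (coeff n (freeTaylor F)) =
      algebraMap 𝕜 A ((n.factorial : 𝕜)⁻¹ * iteratedFDeriv 𝕜 n F 0 fun _ => y) := by
  refine (map_freeAlgebra_lift (Algebra.ofId 𝕜 A) y _).symm.trans ?_
  simp [lift_coeff_freeTaylor, multilinear_const_eq_sum_single, List.prod_ofFn, Algebra.ofId_apply]

variable {A : Type*} [NormedRing A] [NormedAlgebra 𝕜 A]

theorem tendsto_smul_nhds_zero {V : Type*} [AddCommGroup V] [Module 𝕜 V] [TopologicalSpace V]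
    [ContinuousSMul 𝕜 V] (y : V) : Tendsto (fun s : 𝕜 => s • y) (𝓝 0) (𝓝 0) := by
  simpa using (show Continuous fun s : 𝕜 => s • y by fun_prop).tendsto 0

theorem hasExpansion_freeTaylor {F : (ι → 𝕜) → 𝕜} (hF : AnalyticAt 𝕜 F 0) (y : ι → 𝕜) :
    HasExpansion (fun s : 𝕜 => algebraMap 𝕜 A (F (s • y)))
      (extend (FreeAlgebra.lift 𝕜 fun i => algebraMap 𝕜 A (y i)) (freeTaylor F)) := by
  obtain ⟨p, r, hp⟩ := hF
  intro n
  have sub_partialSum : (fun s : 𝕜 => F (s • y) - p.partialSum n (s • y)) =O[𝓝 0]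
      fun s : 𝕜 => s ^ n := by
    refine ((hp.hasFPowerSeriesAt.isBigO_sub_partialSum_pow n).comp_tendsto
      (tendsto_smul_nhds_zero y)).trans (k := fun s : 𝕜 => s ^ n) ?_ |>.congr_left fun s => by simp
    refine .of_bound (‖y‖ ^ n) (.of_forall fun s => ?_)
    simp [norm_smul, mul_pow, mul_comm]
  refine ((sub_partialSum.smul (isBigO_const_const (1 : A) (one_ne_zero (α := 𝕜)) (𝓝 0))).congr_left
    fun s => ?_).congr_right fun s => by simp
  simp only [sub_smul, FormalMultilinearSeries.partialSum, Finset.sum_smul,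
    Algebra.algebraMap_eq_smul_one (F _)]
  congr! 2 with k
  rw [coeff_extend, lift_coeff_freeTaylor_algebraMap, ← hp.factorial_smul y k, nsmul_eq_mul,
    inv_mul_cancel_left₀ (by exact_mod_cast k.factorial_ne_zero),
    ContinuousMultilinearMap.map_smul_univ (p k) (fun _ => s) (fun _ => y)]
  simp [Algebra.algebraMap_eq_smul_one, smul_smul]

theorem translatesOrigin_freeTaylor [CompleteSpace A] {F : ι → (ι → 𝕜) → 𝕜}
    (hF : ∀ ν, AnalyticAt 𝕜 (F ν) 0) (hF0 : ∀ ν, F ν 0 = 0) {α E : ι → A} {p : A}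
    (h : ∀ᶠ y in 𝓝 0, NormedSpace.exp (-∑ ν, F ν y • α ν) * p = p - ∑ i, y i • E i) :
    TranslatesOrigin (fun ν => freeTaylor (F ν)) α p E := by
  intro y
  have exponent : HasExpansion (fun s : 𝕜 => -∑ ν, algebraMap 𝕜 A (F ν (s • y)) * α ν)
      (twistExponent (fun ν => freeTaylor (F ν)) (fun i => algebraMap 𝕜 A (y i)) α) :=
    (HasExpansion.sum _ fun ν _ => (hasExpansion_freeTaylor (hF ν) y).mul (.const (α ν))).neg
  have translation := (HasExpansion.const (𝕜 := 𝕜) p).sub (.smul_const (∑ i, y i • E i))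
  refine ((exponent.exp (constantCoeff_twistExponent (fun ν => constantCoeff_freeTaylor (hF0 ν))
    _ _)).mul (.const p)).unique (translation.congr ?_)
  filter_upwards [(tendsto_smul_nhds_zero y).eventually h] with s hs
  simpa [Finset.smul_sum, smul_smul, ← Algebra.smul_def] using hs.symm

end Taylor

section TwistingElement

variable {𝕜 : Type*} [RCLike 𝕜] {L : Type*} [LieRing L] [LieAlgebra 𝕜 L] {d : ℕ}
  (ρ : L →ₗ⁅𝕜⁆ Module.End 𝕜 L) (b : Module.Basis (Fin d) 𝕜 L) (ψ : L → L)

theorem taylorX_eq_extend_freeTaylor (ν : Fin d) :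
    taylorX ρ b ψ ν =
      extend (FreeAlgebra.lift 𝕜 fun i => genX ρ (b.coord i)) (freeTaylor (coordFun b ψ ν)) := by
  ext n
  rw [taylorX, PowerSeries.coeff_mk, coeff_extend, lift_coeff_freeTaylor]

theorem twistingElement_eq_twistSeries :
    twistingElement ρ b ψ = twistSeries ρ b fun ν => freeTaylor (coordFun b ψ ν) := by
  rw [twistingElement, twistSeries]
  congr 1
  ext n
  rw [PowerSeries.coeff_mk, coeff_twistExponent]
  congr! 2 with ν
  have taylor_includeLeft := map_freeAlgebra_lift (Algebra.TensorProduct.includeLeft :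
    USemidirect ρ →ₐ[𝕜] USemidirect ρ ⊗[𝕜] USemidirect ρ) (fun i => genX ρ (b.coord i))
    (PowerSeries.coeff n (freeTaylor (coordFun b ψ ν)))
  rw [← coeff_extend (FreeAlgebra.lift _ _), ← taylorX_eq_extend_freeTaylor,
    Algebra.TensorProduct.includeLeft_apply] at taylor_includeLeft
  simp only [Function.comp_def, Algebra.TensorProduct.includeLeft_apply] at taylor_includeLeft
  rw [← taylor_includeLeft, Algebra.TensorProduct.tmul_mul_tmul, mul_one, one_mul]

end TwistingElement

/-! ### The local inverse of an orbit map -/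

section LocalInverse

variable {𝕜 : Type*} [RCLike 𝕜] {X Y : Type*} [NormedAddCommGroup X] [NormedSpace 𝕜 X]
  [CompleteSpace X] [NormedAddCommGroup Y] [NormedSpace 𝕜 Y]

theorem analyticAt_of_eventually_leftInverse {f : X → Y} {g : Y → X} {f' : X ≃L[𝕜] Y} {a : X}
    (hf : AnalyticAt 𝕜 f a) (hf' : HasFDerivAt f (f' : X →L[𝕜] Y) a)
    (hg : ∀ᶠ x in 𝓝 a, g (f x) = x) :
    AnalyticAt 𝕜 g (f a) ∧ ∀ᶠ y in 𝓝 (f a), f (g y) = y := by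
  have strict : HasStrictFDerivAt f (f' : X →L[𝕜] Y) a := by
    simpa only [hf'.fderiv] using hf.hasStrictFDerivAt
  have eq_localInverse := strict.localInverse_unique hg
  refine ⟨?_, ?_⟩
  · refine AnalyticAt.congr ?_ (eq_localInverse.mono fun _ h => h.symm)
    exact (strict.toOpenPartialHomeomorph f).analyticAt_symm'
      strict.mem_toOpenPartialHomeomorph_source hf hf'.fderiv
  · filter_upwards [eq_localInverse, strict.eventually_right_inverse] with y hy hfy
    rw [hy, hfy]

end LocalInverse

section ExpOrbit

variable {𝕜 : Type*} [RCLike 𝕜] {X V : Type*} [NormedAddCommGroup X] [NormedSpace 𝕜 X]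
  [NormedAddCommGroup V] [NormedSpace 𝕜 V] [CompleteSpace V]

theorem analyticAt_exp_neg_apply (a : X →L[𝕜] (V →L[𝕜] V)) (v : V) (x : X) :
    AnalyticAt 𝕜 (fun x => NormedSpace.exp (-a x) v) x :=
  ((ContinuousLinearMap.apply 𝕜 V v).analyticAt _).comp (AnalyticAt.comp (f := fun x => -a x)
    (NormedSpace.exp_analytic (𝕂 := 𝕜) (-a x)) (a.analyticAt x).neg)

theorem hasFDerivAt_exp_neg_apply_zero (a : X →L[𝕜] (V →L[𝕜] V)) (v : V) :
    HasFDerivAt (fun x => NormedSpace.exp (-a x) v)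
      (-(ContinuousLinearMap.apply 𝕜 V v).comp a) 0 := by
  have deriv_exp : HasFDerivAt (NormedSpace.exp : (V →L[𝕜] V) → _)
      (1 : (V →L[𝕜] V) →L[𝕜] _) (-a 0) := by
    simpa using hasFDerivAt_exp_zero (𝕂 := 𝕜) (𝔸 := V →L[𝕜] V)
  refine ((ContinuousLinearMap.apply 𝕜 V v).hasFDerivAt.comp 0
    (deriv_exp.comp 0 a.hasFDerivAt.neg)).congr_fderiv ?_
  ext x
  simp

end ExpOrbit

section OrbitInverse

open Filter

variable {𝕜 : Type*} [RCLike 𝕜] {X : Type*} [NormedAddCommGroup X] [NormedSpace 𝕜 X]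
  [FiniteDimensional 𝕜 X]

theorem analyticAt_of_leftInverse_exp (a : X →L[𝕜] (X × 𝕜 →L[𝕜] X × 𝕜))
    (hinj : ∀ x, (a x (0, 1)).1 = 0 → x = 0) {g ψ : X → X}
    (hg : ∀ᶠ x in 𝓝 0, NormedSpace.exp (-a x) (0, 1) = (-g x, 1))
    (hψ : ∀ᶠ x in 𝓝 0, ψ (g x) = x) :
    ψ 0 = 0 ∧ AnalyticAt 𝕜 ψ 0 ∧
      ∀ᶠ y in 𝓝 0, NormedSpace.exp (-a (ψ y)) (0, 1) = (-y, 1) := by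
  have : CompleteSpace X := FiniteDimensional.complete 𝕜 X
  let f : X → X := fun x => -(NormedSpace.exp (-a x) (0, 1)).1
  have f_zero : f 0 = 0 := by simp [f]
  have eventually_eq : f =ᶠ[𝓝 0] g := hg.mono fun x hx => by simp [f, hx]
  have left_inv : ∀ᶠ x in 𝓝 0, ψ (f x) = x :=
    hψ.mp (eventually_eq.mono fun x hfg hx => hfg ▸ hx)
  have analytic : AnalyticAt 𝕜 f 0 :=
    (((ContinuousLinearMap.fst 𝕜 X 𝕜).analyticAt _).comp
      (analyticAt_exp_neg_apply a (0, 1) 0)).neg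
  let evFst : (X × 𝕜 →L[𝕜] X × 𝕜) →L[𝕜] X :=
    (ContinuousLinearMap.fst 𝕜 X 𝕜).comp (ContinuousLinearMap.apply 𝕜 (X × 𝕜) ((0, 1) : X × 𝕜))
  let D : X ≃L[𝕜] X := (LinearEquiv.ofInjectiveEndo (evFst.comp a).toLinearMap
    ((injective_iff_map_eq_zero _).2 hinj)).toContinuousLinearEquiv
  have deriv : HasFDerivAt f (D : X →L[𝕜] X) 0 := by
    refine (((ContinuousLinearMap.fst 𝕜 X 𝕜).hasFDerivAt.comp 0
      (hasFDerivAt_exp_neg_apply_zero a (0, 1))).neg).congr_fderiv ?_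
    ext x
    simp [D, evFst]
  have ψ_zero : ψ 0 = 0 := by simpa [f_zero] using left_inv.self_of_nhds
  obtain ⟨analytic_ψ, right_inv⟩ := analyticAt_of_eventually_leftInverse analytic deriv left_inv
  rw [f_zero] at analytic_ψ right_inv
  have tendsto_ψ : Tendsto ψ (𝓝 0) (𝓝 0) := by
    simpa [ψ_zero] using analytic_ψ.continuousAt.tendsto
  refine ⟨ψ_zero, analytic_ψ, ?_⟩
  filter_upwards [right_inv, tendsto_ψ.eventually hg, tendsto_ψ.eventually eventually_eq]
    with y hy hexp hfg
  rw [hexp, ← hfg, hy]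

end OrbitInverse

/-! ### The affine representation in coordinates -/

section AffineTwist

variable {𝕜 : Type*} [RCLike 𝕜] {L : Type*} [LieRing L] [LieAlgebra 𝕜 L] {d : ℕ}
  (b : Module.Basis (Fin d) 𝕜 L)

/-- The coordinates of `L × 𝕜` defined by a basis of `L`; they serve to norm the endomorphisms of
`L × 𝕜`. -/
noncomputable def prodCoords : (L × 𝕜) ≃ₗ[𝕜] ((Fin d → 𝕜) × 𝕜) :=
  b.equivFun.prodCongr (LinearEquiv.refl 𝕜 𝕜)

/-- Endomorphisms of `L × 𝕜` as bounded operators in coordinates. -/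
noncomputable def endCoords : Module.End 𝕜 (L × 𝕜) ≃ₐ[𝕜]
    ((Fin d → 𝕜) × 𝕜 →L[𝕜] (Fin d → 𝕜) × 𝕜) :=
  ((prodCoords b).conjAlgEquiv 𝕜).trans (Module.End.toContinuousLinearMap ((Fin d → 𝕜) × 𝕜))

theorem endCoords_apply (F : Module.End 𝕜 (L × 𝕜)) (w : (Fin d → 𝕜) × 𝕜) :
    endCoords b F w =
      (b.equivFun (F (b.equivFun.symm w.1, w.2)).1, (F (b.equivFun.symm w.1, w.2)).2) := rfl

theorem mul_endCoords_originProj {T : (Fin d → 𝕜) × 𝕜 →L[𝕜] (Fin d → 𝕜) × 𝕜} {y : Fin d → 𝕜}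
    (hT : T (0, 1) = (-y, 1)) : T * endCoords b (originProj 𝕜 L) =
      endCoords b (originProj 𝕜 L) - ∑ i, y i • endCoords b (translationEnd 𝕜 (b i)) := by
  refine ContinuousLinearMap.ext fun w => ?_
  have originProj_w : endCoords b (originProj 𝕜 L) w = w.2 • ((0, 1) : (Fin d → 𝕜) × 𝕜) := by
    simp [endCoords_apply, originProj_apply]
  have translation_w :
      (∑ i, y i • endCoords b (translationEnd 𝕜 (b i))) w = w.2 • (y, 0) := by
    simp only [← map_smul, ← map_sum]
    rw [← b.equivFun_symm_apply y, endCoords_apply, translationEnd_apply]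
    simp only [map_smul, LinearEquiv.apply_symm_apply, Prod.smul_mk, smul_zero]
  rw [mul_apply_eq_comp, sub_apply, originProj_w, translation_w,
    map_smul, hT, ← smul_sub]
  simp

variable (ρ : L →ₗ⁅𝕜⁆ Module.End 𝕜 L) (D : L →ₗ[𝕜] L)
  (hD : ∀ x y, D ⁅x, y⁆ = ρ x (D y) - ρ y (D x))

/-- The affine representation in coordinates. -/
noncomputable def affineCoords : (Fin d → 𝕜) →L[𝕜] ((Fin d → 𝕜) × 𝕜 →L[𝕜] (Fin d → 𝕜) × 𝕜) :=
  LinearMap.toContinuousLinearMap ((endCoords b).toLinearMap ∘ₗ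
    (affineRep ρ D hD).toLinearMap ∘ₗ b.equivFun.symm.toLinearMap)

theorem affineCoords_eq_endCoords (x : Fin d → 𝕜) :
    affineCoords b ρ D hD x = endCoords b (affineRep ρ D hD (b.equivFun.symm x)) := rfl

theorem affineCoords_apply (x : Fin d → 𝕜) (w : (Fin d → 𝕜) × 𝕜) :
    affineCoords b ρ D hD x w =
      (b.equivFun (ρ (b.equivFun.symm x) (b.equivFun.symm w.1) + w.2 • D (b.equivFun.symm x)),
        0) := by
  rw [affineCoords_eq_endCoords, endCoords_apply, affineRep_apply]

variable {D}

theorem eq_zero_of_affineCoords_apply (hinj : Function.Injective D) {x : Fin d → 𝕜}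
    (hx : (affineCoords b ρ D hD x (0, 1)).1 = 0) : x = 0 := by
  rw [affineCoords_apply, LinearEquiv.map_eq_zero_iff, map_zero, map_zero, zero_add, one_smul,
    map_eq_zero_iff D hinj] at hx
  exact b.equivFun.symm.map_eq_zero_iff.1 hx

theorem coordFun_apply (ψ : L → L) (ν : Fin d) (y : Fin d → 𝕜) :
    coordFun b ψ ν y = b.equivFun (ψ (b.equivFun.symm y)) ν := by
  rw [coordFun, b.equivFun_symm_apply, b.coord_apply, b.equivFun_apply]

theorem sum_coordFun_smul_endCoords (ψ : L → L) (y : Fin d → 𝕜) :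
    ∑ ν, coordFun b ψ ν y • endCoords b (affineRep ρ D hD (b ν)) =
      affineCoords b ρ D hD (b.equivFun (ψ (b.equivFun.symm y))) := by
  simp only [coordFun_apply, ← map_smul, ← map_sum]
  rw [← b.equivFun_symm_apply, affineCoords_eq_endCoords]

theorem translatesOrigin_of_affineCoords {ψ : L → L} (ψ_zero : ψ 0 = 0)
    (analytic : AnalyticAt 𝕜 (fun y => b.equivFun (ψ (b.equivFun.symm y))) 0)
    (orbit : ∀ᶠ y in 𝓝 0, NormedSpace.exp (-affineCoords b ρ D hD
      (b.equivFun (ψ (b.equivFun.symm y)))) (0, 1) = (-y, 1)) :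
    TranslatesOrigin (fun ν => freeTaylor (coordFun b ψ ν))
      (fun ν => affineUHom ρ D hD (genH ρ (b ν))) (originProj 𝕜 L) (translationEnd 𝕜 ∘ b) := by
  have analytic_coordFun (ν : Fin d) : AnalyticAt 𝕜 (coordFun b ψ ν) 0 := by
    simp only [funext (coordFun_apply b ψ ν)]
    exact ((ContinuousLinearMap.proj (R := 𝕜) (φ := fun _ : Fin d => 𝕜) ν).analyticAt _).comp
      analytic
  refine .of_algEquiv (endCoords b) (translatesOrigin_freeTaylor analytic_coordFun
    (fun ν => by simp [coordFun_apply, ψ_zero]) ?_)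
  filter_upwards [orbit] with y hy
  simp only [Function.comp_apply, affineUHom_genH, sum_coordFun_smul_endCoords]
  exact mul_endCoords_originProj b hy

theorem isTwistingCocycle_of_affineCoords (hinj : Function.Injective D) {g ψ : L → L}
    (hg : ∀ᶠ x in 𝓝 (0 : Fin d → 𝕜), NormedSpace.exp (-affineCoords b ρ D hD x) (0, 1) =
      (-b.equivFun (g (b.equivFun.symm x)), 1))
    (hψ : ∀ᶠ x in 𝓝 (0 : Fin d → 𝕜), ψ (g (b.equivFun.symm x)) = b.equivFun.symm x) :
    IsTwistingCocycle (degreePart ρ) (twistingElement ρ b ψ) := by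
  obtain ⟨ψ_zero, analytic, orbit⟩ := analyticAt_of_leftInverse_exp (X := Fin d → 𝕜)
    (affineCoords b ρ D hD)
    (fun x => eq_zero_of_affineCoords_apply b ρ hD hinj)
    (ψ := fun y => b.equivFun (ψ (b.equivFun.symm y))) hg (hψ.mono fun x hx => by
      rw [LinearEquiv.symm_apply_apply, hx, LinearEquiv.apply_symm_apply])
  replace ψ_zero : ψ 0 = 0 := by simpa using ψ_zero
  have translates := translatesOrigin_of_affineCoords b ρ hD ψ_zero analytic orbit
  have : FiniteDimensional 𝕜 L := Module.Finite.of_basis b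
  obtain ⟨D', rfl⟩ : ∃ D' : L ≃ₗ[𝕜] L, D'.toLinearMap = D :=
    ⟨LinearEquiv.ofInjectiveEndo D hinj, rfl⟩
  rw [twistingElement_eq_twistSeries]
  exact isTwistingCocycle_twistSeries b
    (fun ν => constantCoeff_freeTaylor (by simp [coordFun_apply, ψ_zero]))
    (fun ν => isHomogeneousSeries_freeTaylor _) hD translates

end AffineTwist

section LinearODE

variable {𝕜 : Type*} [RCLike 𝕜] {V : Type*} [NormedAddCommGroup V] [NormedSpace 𝕜 V]
  [CompleteSpace V]

theorem exp_neg_apply_of_hasDerivAt (A : V →L[𝕜] V) {u : 𝕜 → V}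
    (hu : ∀ t, HasDerivAt u (-A (u t)) t) : NormedSpace.exp (-A) (u 0) = u 1 := by
  let : NormedAlgebra ℚ (V →L[𝕜] V) := NormedAlgebra.restrictScalars ℚ 𝕜 _
  have deriv_zero (t : 𝕜) : HasDerivAt (fun s : 𝕜 => NormedSpace.exp (s • A) (u s)) 0 t := by
    simpa using (hasDerivAt_exp_smul_const A t).clm_apply (hu t)
  have u_zero : u 0 = NormedSpace.exp A (u 1) := by
    simpa using is_const_of_deriv_eq_zero (fun t => (deriv_zero t).differentiableAt)
      (fun t => (deriv_zero t).deriv) 0 1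
  have exp_neg_mul_exp : NormedSpace.exp (-A) * NormedSpace.exp A = 1 := by
    rw [← NormedSpace.exp_add_of_commute (Commute.refl A).neg_left, neg_add_cancel,
      NormedSpace.exp_zero]
  rw [u_zero]
  exact DFunLike.congr_fun exp_neg_mul_exp (u 1)

end LinearODE

/-! ### Differentiating a group cocycle -/

theorem mfderiv_pi_apply {𝕜 : Type*} [NontriviallyNormedField 𝕜] {E : Type*}
    [NormedAddCommGroup E] [NormedSpace 𝕜 E] {M : Type*} [TopologicalSpace M] [ChartedSpace E M]
    {ι : Type*} [Fintype ι] {f : M → ι → 𝕜} {z : M}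
    (hf : MDifferentiableAt 𝓘(𝕜, E) 𝓘(𝕜, ι → 𝕜) f z) (u : TangentSpace 𝓘(𝕜, E) z) (i : ι) :
    (mfderiv 𝓘(𝕜, E) 𝓘(𝕜, ι → 𝕜) f z u : ι → 𝕜) i =
      mfderiv 𝓘(𝕜, E) 𝓘(𝕜, 𝕜) (fun g => f g i) z u := by
  have h := ((ContinuousLinearMap.proj (R := 𝕜) (φ := fun _ : ι => 𝕜) i).hasMFDerivAt).comp z
    hf.hasMFDerivAt
  exact (DFunLike.congr_fun h.mfderiv u).symm

section GroupInverse

variable {𝕜 : Type*} [NontriviallyNormedField 𝕜] {E : Type*} [NormedAddCommGroup E]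
  [NormedSpace 𝕜 E] {M : Type*} [TopologicalSpace M] {I : ModelWithCorners 𝕜 E M}
  {G : Type*} [TopologicalSpace G] [ChartedSpace M G] [Group G] {n : WithTop ℕ∞} [LieGroup I n G]

theorem mfderiv_inv_one (hn : n ≠ 0) (x : GroupLieAlgebra I G) :
    (mfderiv I I (fun a : G => a⁻¹) 1 x : E) = -(x : E) := by
  have inv := ((contMDiff_inv I n (G := G)).mdifferentiableAt hn (x := 1)).hasMFDerivAt
  have mul := (contMDiff_mul I n (G := G)).mdifferentiableAt hn (x := (1, 1⁻¹))
  have mul_inv := mul.hasMFDerivAt.comp (1 : G) ((hasMFDerivAt_id (1 : G)).prodMk inv)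
  have mul_inv_eq_one : (fun p : G × G => p.1 * p.2) ∘ (fun a => (id a, a⁻¹)) = fun _ => 1 := by
    funext a
    simp
  have deriv_zero := DFunLike.congr_fun
    (hasMFDerivAt_unique (mul_inv_eq_one ▸ mul_inv) (hasMFDerivAt_const (1 : G) (1 : G))) x
  have mul_one_inv : mfderiv I I (fun z : G => z * 1⁻¹) 1 = ContinuousLinearMap.id 𝕜 E :=
    ((hasMFDerivAt_id (1 : G)).congr_of_eventuallyEq (.of_forall fun z => by simp)).mfderiv
  have one_mul : mfderiv I I (fun z : G => 1 * z) 1⁻¹ = ContinuousLinearMap.id 𝕜 E :=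
    ((hasMFDerivAt_id (1⁻¹ : G)).congr_of_eventuallyEq (.of_forall fun z => by simp)).mfderiv
  let v : E := mfderiv I I (fun a : G => a⁻¹) 1 x
  have deriv_mul := mfderiv_prod_eq_add_apply mul (v := ((x, v) : E × E))
  refine eq_neg_of_add_eq_zero_right (α := E) (Eq.trans ?_ (deriv_mul.symm.trans deriv_zero))
  exact congrArg₂ (fun u w : E => u + w) (DFunLike.congr_fun mul_one_inv x).symm
    (DFunLike.congr_fun one_mul v).symm

end GroupInverse

section GroupCocycle

variable {𝕜 : Type*} [RCLike 𝕜] {E : Type*} [NormedAddCommGroup E] [NormedSpace 𝕜 E]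
  {G : Type*} [TopologicalSpace G] [ChartedSpace E G] [Group G]
  {d : ℕ} (H : Module.Basis (Fin d) 𝕜 (GroupLieAlgebra 𝓘(𝕜, E) G))
  {φ : G → GroupLieAlgebra 𝓘(𝕜, E) G}

theorem IsSmoothVec.contMDiff_coords {f : G → GroupLieAlgebra 𝓘(𝕜, E) G}
    (hf : IsSmoothVec 𝕜 E f) :
    ContMDiff 𝓘(𝕜, E) 𝓘(𝕜, Fin d → 𝕜) ∞ fun g => H.equivFun (f g) :=
  contMDiff_pi_space.2 fun i => hf (H.coord i)

theorem IsSmoothVec.mdifferentiableAt_coords {f : G → GroupLieAlgebra 𝓘(𝕜, E) G}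
    (hf : IsSmoothVec 𝕜 E f) (g : G) :
    MDifferentiableAt 𝓘(𝕜, E) 𝓘(𝕜, Fin d → 𝕜) (fun g => H.equivFun (f g)) g :=
  (hf.contMDiff_coords H).mdifferentiableAt (by simp)

-- The two names `g = h` of the base point absorb identities such as `1 * g = g`, along which the
-- tangent spaces are not syntactically equal.
theorem IsSmoothVec.hasMFDerivAt_coords {f : G → GroupLieAlgebra 𝓘(𝕜, E) G}
    (hf : IsSmoothVec 𝕜 E f) {g h : G} (hgh : h = g) :
    HasMFDerivAt 𝓘(𝕜, E) 𝓘(𝕜, Fin d → 𝕜) (fun g => H.equivFun (f g)) h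
      (mfderiv 𝓘(𝕜, E) 𝓘(𝕜, Fin d → 𝕜) (fun g => H.equivFun (f g)) g : E →L[𝕜] (Fin d → 𝕜)) := by
  subst hgh
  exact (hf.mdifferentiableAt_coords H h).hasMFDerivAt

theorem IsGroupCocycle.apply_one {π : Representation 𝕜 G (GroupLieAlgebra 𝓘(𝕜, E) G)}
    (hφ : IsGroupCocycle π φ) : φ 1 = 0 := by
  have cocycle_one := hφ.cocycle 1 1
  rw [mul_one, inv_one, map_one, Module.End.one_apply] at cocycle_one
  exact left_eq_add.1 cocycle_one

/-- The differential of a group cocycle at the identity, computed in the coordinates of `H`. -/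
noncomputable def cocycleDiff (φ : G → GroupLieAlgebra 𝓘(𝕜, E) G) :
    GroupLieAlgebra 𝓘(𝕜, E) G →ₗ[𝕜] GroupLieAlgebra 𝓘(𝕜, E) G :=
  H.equivFun.symm.toLinearMap ∘ₗ
    (mfderiv 𝓘(𝕜, E) 𝓘(𝕜, Fin d → 𝕜) (fun g => H.equivFun (φ g)) 1 :
      GroupLieAlgebra 𝓘(𝕜, E) G →L[𝕜] (Fin d → 𝕜)).toLinearMap

theorem equivFun_cocycleDiff (x : GroupLieAlgebra 𝓘(𝕜, E) G) :
    H.equivFun (cocycleDiff H φ x) =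
      mfderiv 𝓘(𝕜, E) 𝓘(𝕜, Fin d → 𝕜) (fun g => H.equivFun (φ g)) 1 x :=
  H.equivFun.apply_symm_apply _

/-- A linear endomorphism of the Lie algebra as a bounded operator on coordinates. -/
noncomputable def operatorCoords (A : Module.End 𝕜 (GroupLieAlgebra 𝓘(𝕜, E) G)) :
    (Fin d → 𝕜) →L[𝕜] (Fin d → 𝕜) :=
  LinearMap.toContinuousLinearMap (H.equivFun.toLinearMap ∘ₗ A ∘ₗ H.equivFun.symm.toLinearMap)

theorem operatorCoords_equivFun (A : Module.End 𝕜 (GroupLieAlgebra 𝓘(𝕜, E) G))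
    (v : GroupLieAlgebra 𝓘(𝕜, E) G) : operatorCoords H A (H.equivFun v) = H.equivFun (A v) :=
  congrArg (fun w => H.equivFun (A w)) (H.equivFun.symm_apply_apply v)

variable [LieGroup 𝓘(𝕜, E) ∞ G]

theorem IsSmoothVec.comp_inv {f : G → GroupLieAlgebra 𝓘(𝕜, E) G}
    (hf : IsSmoothVec 𝕜 E f) : IsSmoothVec 𝕜 E fun g => f g⁻¹ :=
  fun ξ => (hf ξ).comp (contMDiff_inv 𝓘(𝕜, E) ∞)

theorem IsGroupCocycle.mfderiv_mul_right
    {π : Representation 𝕜 G (GroupLieAlgebra 𝓘(𝕜, E) G)} (hφ : IsGroupCocycle π φ)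
    (x : GroupLieAlgebra 𝓘(𝕜, E) G) (g : G) :
    (mfderiv 𝓘(𝕜, E) 𝓘(𝕜, Fin d → 𝕜) (fun g => H.equivFun (φ g)) g
      (mfderiv 𝓘(𝕜, E) 𝓘(𝕜, E) (fun a => a * g) 1 x : E) : Fin d → 𝕜) =
      H.equivFun (π g⁻¹ (cocycleDiff H φ x)) := by
  have deriv_comp := (hφ.smooth.hasMFDerivAt_coords H (one_mul g)).comp (1 : G)
    ((contMDiff_mul_right (I := 𝓘(𝕜, E)) (n := ∞) (a := g)).mdifferentiableAt
      (by simp)).hasMFDerivAt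
  have deriv_add := (hasMFDerivAt_const (I := 𝓘(𝕜, E)) (I' := 𝓘(𝕜, Fin d → 𝕜))
    (H.equivFun (φ g)) (1 : G)).add ((operatorCoords H (π g⁻¹)).hasMFDerivAt.comp (1 : G)
      (hφ.smooth.hasMFDerivAt_coords H (rfl : (1 : G) = 1)))
  have comp_eq_add : (fun a => H.equivFun (φ a)) ∘ (fun a => a * g) =
      (fun _ => H.equivFun (φ g)) +
        operatorCoords H (π g⁻¹) ∘ fun a => H.equivFun (φ a) := by
    funext a
    simp only [Function.comp_apply, hφ.cocycle g a, map_add, Pi.add_apply, operatorCoords_equivFun]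
  rw [comp_eq_add] at deriv_comp
  refine (DFunLike.congr_fun (hasMFDerivAt_unique deriv_comp deriv_add) x).trans ?_
  rw [← operatorCoords_equivFun, equivFun_cocycleDiff]
  exact zero_add _

variable [CompleteSpace E]
  {ρ : GroupLieAlgebra 𝓘(𝕜, E) G →ₗ⁅𝕜⁆ Module.End 𝕜 (GroupLieAlgebra 𝓘(𝕜, E) G)}
  {π : Representation 𝕜 G (GroupLieAlgebra 𝓘(𝕜, E) G)}

theorem IntegratesAction.mfderiv_inv (hπ : IntegratesAction ρ π)
    (x v : GroupLieAlgebra 𝓘(𝕜, E) G) (ξ : Module.Dual 𝕜 (GroupLieAlgebra 𝓘(𝕜, E) G)) :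
    mfderiv 𝓘(𝕜, E) 𝓘(𝕜, 𝕜) (fun g => ξ (π g⁻¹ v)) 1 x = -ξ (ρ x v) := by
  let T : E →L[𝕜] 𝕜 := mfderiv 𝓘(𝕜, E) 𝓘(𝕜, 𝕜) (fun g => ξ (π g v)) (1 : G)
  have deriv_π : HasMFDerivAt 𝓘(𝕜, E) 𝓘(𝕜, 𝕜) (fun g => ξ (π g v)) (1 : G)⁻¹ T :=
    (inv_one (G := G)).symm ▸ ((hπ.smooth v ξ).mdifferentiableAt (by simp)).hasMFDerivAt
  have deriv_inv := deriv_π.comp (1 : G)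
    ((contMDiff_inv 𝓘(𝕜, E) ∞ (G := G)).mdifferentiableAt (by simp)).hasMFDerivAt
  refine (DFunLike.congr_fun deriv_inv.mfderiv x).trans ?_
  rw [← hπ.deriv]
  exact (congrArg T (mfderiv_inv_one (n := ∞) (by simp) x)).trans (T.map_neg x)

theorem IntegratesAction.mfderiv_inv_coords (hπ : IntegratesAction ρ π)
    (x v : GroupLieAlgebra 𝓘(𝕜, E) G) :
    (mfderiv 𝓘(𝕜, E) 𝓘(𝕜, Fin d → 𝕜) (fun g => H.equivFun (π g⁻¹ v)) 1 x : Fin d → 𝕜) =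
      -H.equivFun (ρ x v) := by
  funext i
  rw [mfderiv_pi_apply ((hπ.smooth v).comp_inv.mdifferentiableAt_coords H 1)]
  exact hπ.mfderiv_inv x v (H.coord i)

theorem IsGroupCocycle.mfderiv_mulInvariantVectorField (hφ : IsGroupCocycle π φ)
    (hπ : IntegratesAction ρ π) (x : GroupLieAlgebra 𝓘(𝕜, E) G) (g : G) :
    (mfderiv 𝓘(𝕜, E) 𝓘(𝕜, Fin d → 𝕜) (fun g => H.equivFun (φ g)) g (mulInvariantVectorField x g) :
      Fin d → 𝕜) = H.equivFun (cocycleDiff H φ x - ρ x (φ g)) := by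
  have deriv_comp := (hφ.smooth.hasMFDerivAt_coords H (mul_one g)).comp (1 : G)
    ((contMDiff_mul_left (I := 𝓘(𝕜, E)) (n := ∞) (a := g)).mdifferentiableAt
      (by simp)).hasMFDerivAt
  have deriv_add := (hφ.smooth.hasMFDerivAt_coords H (rfl : (1 : G) = 1)).add
    ((hπ.smooth (φ g)).comp_inv.hasMFDerivAt_coords H (rfl : (1 : G) = 1))
  have comp_eq_add : (fun a => H.equivFun (φ a)) ∘ (fun a => g * a) =
      (fun a => H.equivFun (φ a)) + fun a => H.equivFun (π a⁻¹ (φ g)) := by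
    funext a
    simp only [Function.comp_apply, hφ.cocycle a g, map_add, Pi.add_apply]
  rw [comp_eq_add] at deriv_comp
  refine (DFunLike.congr_fun (hasMFDerivAt_unique deriv_comp deriv_add) x).trans ?_
  rw [map_sub, sub_eq_add_neg, ← hπ.mfderiv_inv_coords H x (φ g), equivFun_cocycleDiff]
  rfl

end GroupCocycle

section CocycleInjective

open Filter

theorem hasDerivAt_of_hasMFDerivAt {𝕜 E F : Type*} [NontriviallyNormedField 𝕜]
    [NormedAddCommGroup E] [NormedSpace 𝕜 E] [NormedAddCommGroup F] [NormedSpace 𝕜 F] {f : 𝕜 → F}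
    {T : E →L[𝕜] F} {v : E} {t : 𝕜}
    (h : HasMFDerivAt 𝓘(𝕜, 𝕜) 𝓘(𝕜, F) f t (T.comp ((1 : 𝕜 →L[𝕜] 𝕜).smulRight v))) :
    HasDerivAt f (T v) t := by
  have fderiv : HasFDerivAt f (T.comp ((1 : 𝕜 →L[𝕜] 𝕜).smulRight v)) t := h.hasFDerivAt
  simpa using fderiv.hasDerivAt

variable {𝕜 : Type*} [RCLike 𝕜] {E : Type*} [NormedAddCommGroup E] [NormedSpace 𝕜 E]
  {G : Type*} [TopologicalSpace G] [ChartedSpace E G] [Group G]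
  {d : ℕ} (H : Module.Basis (Fin d) 𝕜 (GroupLieAlgebra 𝓘(𝕜, E) G))

theorem isOneParameterSubgroup_zero :
    IsOneParameterSubgroup (0 : GroupLieAlgebra 𝓘(𝕜, E) G) fun _ : 𝕜 => (1 : G) := by
  refine ⟨rfl, fun t => ?_⟩
  have velocity_zero : (1 : 𝕜 →L[𝕜] 𝕜).smulRight (mulInvariantVectorField
      (0 : GroupLieAlgebra 𝓘(𝕜, E) G) (1 : G)) = 0 := by
    refine ContinuousLinearMap.ext fun c => ?_
    rw [ContinuousLinearMap.smulRight_apply, mulInvariantVectorField, map_zero]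
    exact smul_zero (A := E) c
  exact velocity_zero ▸ hasMFDerivAt_const (I := 𝓘(𝕜, 𝕜)) (I' := 𝓘(𝕜, E)) (1 : G) t

theorem lieExp_eq_one {x : GroupLieAlgebra 𝓘(𝕜, E) G}
    (h : ¬∃ γ : 𝕜 → G, IsOneParameterSubgroup x γ) : lieExp x = 1 :=
  dif_neg h

theorem exists_isOneParameterSubgroup_lieExp_eq {x : GroupLieAlgebra 𝓘(𝕜, E) G}
    (h : ∃ γ : 𝕜 → G, IsOneParameterSubgroup x γ) :
    ∃ γ : 𝕜 → G, IsOneParameterSubgroup x γ ∧ lieExp x = γ 1 :=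
  ⟨h.choose, h.choose_spec, dif_pos h⟩

variable [LieGroup 𝓘(𝕜, E) ∞ G] [CompleteSpace E]
  {ρ : GroupLieAlgebra 𝓘(𝕜, E) G →ₗ⁅𝕜⁆ Module.End 𝕜 (GroupLieAlgebra 𝓘(𝕜, E) G)}
  {π : Representation 𝕜 G (GroupLieAlgebra 𝓘(𝕜, E) G)}
  {φ : G → GroupLieAlgebra 𝓘(𝕜, E) G}
  {ψ : GroupLieAlgebra 𝓘(𝕜, E) G → GroupLieAlgebra 𝓘(𝕜, E) G}

theorem IsGroupCocycle.hasDerivAt_comp (hφ : IsGroupCocycle π φ) (hπ : IntegratesAction ρ π)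
    {x : GroupLieAlgebra 𝓘(𝕜, E) G} {γ : 𝕜 → G} (hγ : IsOneParameterSubgroup x γ) (t : 𝕜) :
    HasDerivAt (fun s => H.equivFun (φ (γ s)))
      (H.equivFun (cocycleDiff H φ x - ρ x (φ (γ t)))) t := by
  rw [← hφ.mfderiv_mulInvariantVectorField H hπ x (γ t)]
  exact hasDerivAt_of_hasMFDerivAt (E := E) (F := Fin d → 𝕜)
    ((hφ.smooth.hasMFDerivAt_coords H (rfl : γ t = γ t)).comp t (hγ.2 t))

theorem IsGroupCocycle.apply_lieExp_eq_zero (hφ : IsGroupCocycle π φ) (hπ : IntegratesAction ρ π)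
    {x : GroupLieAlgebra 𝓘(𝕜, E) G} (hx : cocycleDiff H φ x = 0) : φ (lieExp x) = 0 := by
  by_cases h : ∃ γ : 𝕜 → G, IsOneParameterSubgroup x γ
  · obtain ⟨γ, hγ, lieExp_eq⟩ := exists_isOneParameterSubgroup_lieExp_eq h
    have flow := exp_neg_apply_of_hasDerivAt (operatorCoords H (ρ x))
      (u := fun s => H.equivFun (φ (γ s))) fun t => by
        have deriv := hφ.hasDerivAt_comp H hπ hγ t
        rwa [hx, zero_sub, map_neg, ← operatorCoords_equivFun] at deriv
    rw [hγ.1, hφ.apply_one, map_zero, map_zero] at flow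
    rw [lieExp_eq]
    exact H.equivFun.map_eq_zero_iff.1 flow.symm
  · rw [lieExp_eq_one h, hφ.apply_one]

theorem IsInverseNearOrigin.apply_zero [FiniteDimensional 𝕜 E] (hψ : IsInverseNearOrigin φ ψ)
    (hφ : IsGroupCocycle π φ) (hπ : IntegratesAction ρ π) : ψ 0 = 0 := by
  have left_inv_zero := hψ.left_inv.self_of_nhds
  rwa [hφ.apply_lieExp_eq_zero (Module.finBasis 𝕜 E) hπ (map_zero _)] at left_inv_zero

theorem IsGroupCocycle.injective_cocycleDiff (hφ : IsGroupCocycle π φ) (hπ : IntegratesAction ρ π)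
    (hψ : IsInverseNearOrigin φ ψ) : Function.Injective (cocycleDiff H φ) := by
  have : FiniteDimensional 𝕜 E := .of_basis H
  rw [injective_iff_map_eq_zero]
  intro x hx
  have smul_eq_zero_near : ∀ᶠ t : 𝕜 in 𝓝 0, t • x = 0 := by
    filter_upwards [(tendsto_smul_nhds_zero x).eventually hψ.left_inv] with t ht
    rw [← ht, hφ.apply_lieExp_eq_zero H hπ (by rw [map_smul, hx, smul_zero]),
      hψ.apply_zero hφ hπ]
  obtain ⟨t, smul_zero, t_ne_zero⟩ := ((smul_eq_zero_near.filter_mono nhdsWithin_le_nhds).and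
    (self_mem_nhdsWithin (a := 0) (s := {0}ᶜ))).exists
  exact (smul_eq_zero.1 smul_zero).resolve_left t_ne_zero

theorem IsInverseNearOrigin.exists_isOneParameterSubgroup [FiniteDimensional 𝕜 E]
    (hψ : IsInverseNearOrigin φ ψ) (hφ : IsGroupCocycle π φ) (hπ : IntegratesAction ρ π) :
    ∀ᶠ x in 𝓝 (0 : GroupLieAlgebra 𝓘(𝕜, E) G), ∃ γ : 𝕜 → G, IsOneParameterSubgroup x γ := by
  filter_upwards [hψ.left_inv] with x hx
  by_contra h
  rw [lieExp_eq_one h, hφ.apply_one, hψ.apply_zero hφ hπ] at hx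
  exact h (hx ▸ ⟨_, isOneParameterSubgroup_zero⟩)

end CocycleInjective

section CocycleBracket

open VectorField

theorem isInvertible_of_surjective_of_finrank_eq {𝕜 E F : Type*} [NontriviallyNormedField 𝕜]
    [CompleteSpace 𝕜] [NormedAddCommGroup E] [NormedSpace 𝕜 E] [FiniteDimensional 𝕜 E]
    [NormedAddCommGroup F] [NormedSpace 𝕜 F] [FiniteDimensional 𝕜 F] {T : E →L[𝕜] F}
    (hT : Function.Surjective T) (hd : Module.finrank 𝕜 E = Module.finrank 𝕜 F) :
    T.IsInvertible := by
  have injective : Function.Injective T.toLinearMap :=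
    (LinearMap.injective_iff_surjective_of_finrank_eq_finrank hd).2 hT
  exact ⟨(LinearEquiv.ofBijective T.toLinearMap ⟨injective, hT⟩).toContinuousLinearEquiv,
    by ext; rfl⟩

theorem lieBracket_const_sub_apply {𝕜 F : Type*} [NontriviallyNormedField 𝕜]
    [NormedAddCommGroup F] [NormedSpace 𝕜 F] (A B : F →L[𝕜] F) (v w : F) :
    lieBracket 𝕜 (fun y => v - A y) (fun y => w - B y) 0 = A w - B v := by
  have fderiv_affine (u : F) (C : F →L[𝕜] F) : fderiv 𝕜 (fun y => u - C y) 0 = -C :=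
    (C.hasFDerivAt.const_sub u).fderiv
  simp only [lieBracket_eq, fderiv_affine, neg_apply, map_zero, sub_zero]
  abel

variable {𝕜 : Type*} [RCLike 𝕜] {E : Type*} [NormedAddCommGroup E] [NormedSpace 𝕜 E]
  {G : Type*} [TopologicalSpace G] [ChartedSpace E G] [Group G] [LieGroup 𝓘(𝕜, E) ∞ G]
  {d : ℕ} (H : Module.Basis (Fin d) 𝕜 (GroupLieAlgebra 𝓘(𝕜, E) G))
  {π : Representation 𝕜 G (GroupLieAlgebra 𝓘(𝕜, E) G)}
  {φ : G → GroupLieAlgebra 𝓘(𝕜, E) G}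

theorem IsGroupCocycle.isInvertible_mfderiv (hφ : IsGroupCocycle π φ)
    (hinj : Function.Injective (cocycleDiff H φ)) (g : G) :
    (mfderiv 𝓘(𝕜, E) 𝓘(𝕜, Fin d → 𝕜) (fun g => H.equivFun (φ g)) g).IsInvertible := by
  have finiteDimensional : FiniteDimensional 𝕜 (GroupLieAlgebra 𝓘(𝕜, E) G) :=
    Module.Finite.of_basis H
  have : FiniteDimensional 𝕜 E := finiteDimensional
  have finrank_eq : Module.finrank 𝕜 E = Module.finrank 𝕜 (Fin d → 𝕜) :=
    (H.equivFun.finrank_eq : Module.finrank 𝕜 (GroupLieAlgebra 𝓘(𝕜, E) G) = _)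
  refine isInvertible_of_surjective_of_finrank_eq (E := E) (F := Fin d → 𝕜) (fun y => ?_)
    finrank_eq
  obtain ⟨x, hx⟩ := LinearMap.injective_iff_surjective.1 hinj (π g (H.equivFun.symm y))
  refine ⟨_, (hφ.mfderiv_mul_right H x g).trans ?_⟩
  rw [hx, ← Module.End.mul_apply, ← map_mul, inv_mul_cancel, map_one, Module.End.one_apply,
    LinearEquiv.apply_symm_apply]

variable [CompleteSpace E]
  {ρ : GroupLieAlgebra 𝓘(𝕜, E) G →ₗ⁅𝕜⁆ Module.End 𝕜 (GroupLieAlgebra 𝓘(𝕜, E) G)}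

/-- The affine vector field `y ↦ D x - x ▷ y` on the coordinate space. A group cocycle with
differential `D` maps the left invariant field of `x` to it. -/
noncomputable def affineField
    (ρ : GroupLieAlgebra 𝓘(𝕜, E) G →ₗ⁅𝕜⁆ Module.End 𝕜 (GroupLieAlgebra 𝓘(𝕜, E) G))
    (D : GroupLieAlgebra 𝓘(𝕜, E) G →ₗ[𝕜] GroupLieAlgebra 𝓘(𝕜, E) G)
    (x : GroupLieAlgebra 𝓘(𝕜, E) G) (y : Fin d → 𝕜) : TangentSpace 𝓘(𝕜, Fin d → 𝕜) y :=
  (H.equivFun (D x) - operatorCoords H (ρ x) y : Fin d → 𝕜)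

theorem mdifferentiableAt_affineField
    (D : GroupLieAlgebra 𝓘(𝕜, E) G →ₗ[𝕜] GroupLieAlgebra 𝓘(𝕜, E) G)
    (x : GroupLieAlgebra 𝓘(𝕜, E) G) (y : Fin d → 𝕜) :
    MDifferentiableAt 𝓘(𝕜, Fin d → 𝕜) 𝓘(𝕜, Fin d → 𝕜).tangent
      (fun y => (⟨y, affineField H ρ D x y⟩ : TangentBundle 𝓘(𝕜, Fin d → 𝕜) (Fin d → 𝕜))) y := by
  have contDiffAt : ContDiffAt 𝕜 1 (fun y => H.equivFun (D x) - operatorCoords H (ρ x) y) y :=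
    contDiffAt_const.sub (operatorCoords H (ρ x)).contDiff.contDiffAt
  exact (contMDiffAt_vectorSpace_iff_contDiffAt.2 contDiffAt).mdifferentiableAt (by simp)

theorem mlieBracket_affineField
    (D : GroupLieAlgebra 𝓘(𝕜, E) G →ₗ[𝕜] GroupLieAlgebra 𝓘(𝕜, E) G)
    (x y : GroupLieAlgebra 𝓘(𝕜, E) G) :
    (mlieBracket 𝓘(𝕜, Fin d → 𝕜) (affineField H ρ D x) (affineField H ρ D y) 0 : Fin d → 𝕜) =
      H.equivFun (ρ x (D y) - ρ y (D x)) := by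
  rw [← mlieBracketWithin_univ, mlieBracketWithin_eq_lieBracketWithin, map_sub,
    ← operatorCoords_equivFun H (ρ x), ← operatorCoords_equivFun H (ρ y),
    ← lieBracket_const_sub_apply, ← lieBracketWithin_univ]
  rfl

theorem IsGroupCocycle.mpullback_affineField (hφ : IsGroupCocycle π φ) (hπ : IntegratesAction ρ π)
    (hinj : Function.Injective (cocycleDiff H φ)) (x : GroupLieAlgebra 𝓘(𝕜, E) G) :
    mpullback 𝓘(𝕜, E) 𝓘(𝕜, Fin d → 𝕜) (fun g => H.equivFun (φ g))
      (affineField H ρ (cocycleDiff H φ) x) = mulInvariantVectorField x := by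
  funext g
  rw [mpullback_apply, (hφ.isInvertible_mfderiv H hinj g).inverse_apply_eq]
  refine Eq.trans ?_ (hφ.mfderiv_mulInvariantVectorField H hπ x g).symm
  rw [map_sub, ← operatorCoords_equivFun H (ρ x)]
  rfl

theorem IsGroupCocycle.cocycleDiff_lie (hφ : IsGroupCocycle π φ) (hπ : IntegratesAction ρ π)
    (hinj : Function.Injective (cocycleDiff H φ)) (x y : GroupLieAlgebra 𝓘(𝕜, E) G) :
    cocycleDiff H φ ⁅x, y⁆ = ρ x (cocycleDiff H φ y) - ρ y (cocycleDiff H φ x) := by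
  have coords_one : H.equivFun (φ 1) = 0 := by rw [hφ.apply_one, map_zero]
  have pullback_bracket := mpullback_mlieBracket (x₀ := (1 : G)) (n := ∞)
    (mdifferentiableAt_affineField H (ρ := ρ) (cocycleDiff H φ) x _)
    (mdifferentiableAt_affineField H (ρ := ρ) (cocycleDiff H φ) y _)
    (hφ.smooth.contMDiff_coords H).contMDiffAt
    (by rw [minSmoothness_of_isRCLikeNormedField]; exact ENat.LEInfty.out)
  rw [hφ.mpullback_affineField H hπ hinj, hφ.mpullback_affineField H hπ hinj,
    ← GroupLieAlgebra.bracket_def, mpullback_apply,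
    (hφ.isInvertible_mfderiv H hinj 1).inverse_apply_eq] at pullback_bracket
  apply H.equivFun.injective
  rw [equivFun_cocycleDiff]
  refine pullback_bracket.symm.trans ?_
  rw [coords_one]
  exact mlieBracket_affineField H _ x y

theorem IsGroupCocycle.exp_affineCoords (hφ : IsGroupCocycle π φ) (hπ : IntegratesAction ρ π)
    (hD : ∀ x y, cocycleDiff H φ ⁅x, y⁆ = ρ x (cocycleDiff H φ y) - ρ y (cocycleDiff H φ x))
    {x : Fin d → 𝕜} (hx : ∃ γ : 𝕜 → G, IsOneParameterSubgroup (H.equivFun.symm x) γ) :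
    NormedSpace.exp (-affineCoords H ρ (cocycleDiff H φ) hD x) (0, 1) =
      (-H.equivFun (φ (lieExp (H.equivFun.symm x))), 1) := by
  obtain ⟨γ, hγ, lieExp_eq⟩ := exists_isOneParameterSubgroup_lieExp_eq hx
  have flow := exp_neg_apply_of_hasDerivAt (affineCoords H ρ (cocycleDiff H φ) hD x)
    (u := fun s => (-H.equivFun (φ (γ s)), 1)) fun t => by
      refine ((hφ.hasDerivAt_comp H hπ hγ t).neg.prodMk
        (hasDerivAt_const t (1 : 𝕜))).congr_deriv ?_
      rw [affineCoords_apply]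
      simp only [LinearEquiv.symm_apply_apply, map_neg, one_smul, Prod.neg_mk, neg_zero]
      rw [← map_neg, ← map_neg, neg_sub, neg_add_rev, neg_neg, neg_add_eq_sub]
  rw [hγ.1, hφ.apply_one, map_zero, neg_zero] at flow
  rw [flow, lieExp_eq]

end CocycleBracket

theorem tendsto_equivFun_symm_zero {𝕜 : Type*} [NontriviallyNormedField 𝕜] [CompleteSpace 𝕜]
    {V : Type*} [AddCommGroup V] [Module 𝕜 V] [TopologicalSpace V] [IsTopologicalAddGroup V]
    [ContinuousSMul 𝕜 V] {ι : Type*} [Finite ι] (b : Module.Basis ι 𝕜 V) :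
    Filter.Tendsto b.equivFun.symm (𝓝 0) (𝓝 0) := by
  simpa using (LinearMap.continuous_of_finiteDimensional b.equivFun.symm.toLinearMap).tendsto 0

theorem theorem3 {𝕜 : Type*} [RCLike 𝕜]
    {E : Type*} [NormedAddCommGroup E] [NormedSpace 𝕜 E] [FiniteDimensional 𝕜 E] [CompleteSpace E]
    {G : Type*} [TopologicalSpace G] [ChartedSpace E G] [Group G] [LieGroup 𝓘(𝕜, E) ∞ G]
    {d : ℕ} (H : Module.Basis (Fin d) 𝕜 (GroupLieAlgebra 𝓘(𝕜, E) G))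
    (ρ : GroupLieAlgebra 𝓘(𝕜, E) G →ₗ⁅𝕜⁆ Module.End 𝕜 (GroupLieAlgebra 𝓘(𝕜, E) G))
    (π : Representation 𝕜 G (GroupLieAlgebra 𝓘(𝕜, E) G)) (hπ : IntegratesAction ρ π)
    (φ : G → GroupLieAlgebra 𝓘(𝕜, E) G) (hφ : IsGroupCocycle π φ)
    (ψ : GroupLieAlgebra 𝓘(𝕜, E) G → GroupLieAlgebra 𝓘(𝕜, E) G)
    (hψ : IsInverseNearOrigin φ ψ) :
    IsTwistingCocycle (degreePart ρ) (twistingElement ρ H ψ) := by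
  have injective := hφ.injective_cocycleDiff H hπ hψ
  have cocycle := hφ.cocycleDiff_lie H hπ injective
  have tendsto_coords := tendsto_equivFun_symm_zero H
  have orbit : ∀ᶠ x in 𝓝 (0 : Fin d → 𝕜),
      NormedSpace.exp (-affineCoords H ρ (cocycleDiff H φ) cocycle x) (0, 1) =
        (-H.equivFun (φ (lieExp (H.equivFun.symm x))), 1) :=
    (tendsto_coords.eventually (hψ.exists_isOneParameterSubgroup hφ hπ)).mono fun _ hx =>
      hφ.exp_affineCoords H hπ cocycle hx
  exact isTwistingCocycle_of_affineCoords H ρ cocycle injective (g := fun x => φ (lieExp x)) orbit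
    (tendsto_coords.eventually hψ.left_inv)
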